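/- Let $S$ be one of the min-plus semirings $\mathsf{R}=(\mathbb{R}\cup\{\infty\},\oplus,\otimes)$ or $\mathsf{R}^{+}=(\mathbb{R}_{\ge 0}\cup\{\infty\},\oplus,\otimes)$, where $\oplus$ is the minimum and $\otimes$ is ordinary addition (so the additive identity is $\infty$ and the multiplicative identity is $0$). A $p$-family over $S$ is a sequence $(f_n)_{n\ge 1}$ of polynomials over $S$ whose numbers of variables and degrees are bounded by polynomials in $n$. A circuit over $S$ is a fan-in-two arithmetic circuit with gates $\oplus,\otimes$ whose inputs are variables and constants of $S$; its size is its number of gates. It computes a polynomial $f$ in $v$ variables if its output polynomial defines the same function $S^v\to S$ as $f$. The class $\mathsf{VP}_S$ consists of the $p$-families $(f_n)_{n\ge1}$ such that $f_n$ has circuits of size polynomially bounded in $n$. For $r:\mathbb{N}\to\mathbb{N}$, the class $\mathsf{VNP}_S^{[r(n)]}$ consists of the $p$-families $(f_n)_{n\ge 1}$ for which there are a family $(g_n)_{n\ge1}\in\mathsf{VP}_S$ and polynomials $p,q$ with natural-number coefficients, with $p(n)\ge 1$ for all $n\ge1$, such that for all $n\ge 1$, as functions of $X$, $$f_n(X)=\bigoplus_{y_1,\dots,y_{q(n)}\in\{\infty,0\}}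 g_{p(n)}\bigl(X,y_1,\dots,y_{q(n)},\overline{y_1},\dots,\overline{y_{r'(n)}}\bigr),\qquad r'(n)=\min(r(n),q(n)),$$ where $\overline{0}=\infty$ and $\overline{\infty}=0$. Let $\mathrm{perm}_k=\bigoplus_{\sigma\in S_k}\bigotimes_{i=1}^{k}x_{i,\sigma(i)}$ denote the permanent of a $k\times k$ matrix of variables. **Theorem.** Let $r:\mathbb{N}\to\mathbb{N}$. 1. If $r(n)=O(\log n)$, then $\mathsf{VP}_S=\mathsf{VNP}_S^{[r(n)]}$ for both $S=\mathsf{R}$ and $S=\mathsf{R}^{+}$. 2. If $r(n)=\omega(\log n)$, then $\mathsf{VP}_S\ne\mathsf{VNP}_S^{[r(n)]}$ for both $S=\mathsf{R}$ and $S=\mathsf{R}^{+}$. Moreover, there is a function $\beta:\mathbb{N}\to\mathbb{N}$ such that, for both choices of $S$, the family $(\mathrm{perm}_{\beta(n)})_{n\ge1}$ belongs to $\mathsf{VNP}_S^{[r(n)]}\setminus\mathsf{VP}_S$. -/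

import Mathlib

open scoped NNReal

/-- The min-plus semiring `(ℝ ∪ {∞}, min, +)`.  Its additive identity is `∞` and its
multiplicative identity is the real number `0`. -/
abbrev MinPlus : Type := Tropical (WithTop ℝ)

/-- The min-plus semiring `(ℝ≥0 ∪ {∞}, min, +)`. -/
abbrev MinPlusNN : Type := Tropical (WithTop ℝ≥0)

/-- A gate of an arithmetic circuit in `v` variables over `S`, which may refer to `m` earlier
gates. -/
inductive Gate (S : Type) (v m : ℕ) : Type
  | const (c : S) : Gate S v m
  | var (i : Fin v) : Gate S v m
  | add (j k : Fin m) : Gate S v m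
  | mul (j k : Fin m) : Gate S v m

/-- An arithmetic circuit of fan-in two in `v` variables over `S`: a directed acyclic graph of
gates listed in topological order, with a designated output gate.  Its size is the total number
of gates, inputs included. -/
structure Circuit (S : Type) (v : ℕ) : Type where
  size : ℕ
  gate : (i : Fin size) → Gate S v i.val
  output : Fin size

/-- The formal polynomial computed at a gate of a circuit. -/
noncomputable def Circuit.gatePoly {S : Type} [CommSemiring S] {v : ℕ} (C : Circuit S v)
    (i : Fin C.size) : MvPolynomial (Fin v) S :=
  match C.gate i with
  | .const c => MvPolynomial.C c
  | .var a => MvPolynomial.X a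
  | .add j k => C.gatePoly ⟨j.val, j.isLt.trans i.isLt⟩ + C.gatePoly ⟨k.val, k.isLt.trans i.isLt⟩
  | .mul j k => C.gatePoly ⟨j.val, j.isLt.trans i.isLt⟩ * C.gatePoly ⟨k.val, k.isLt.trans i.isLt⟩
termination_by i.val
decreasing_by all_goals simp

/-- Two formal polynomials are identified when they define the same function on `S ^ v`. So a
circuit computes `f` if its output polynomial defines the same function as `f`. -/
def Circuit.Computes {S : Type} [CommSemiring S] {v : ℕ} (C : Circuit S v)
    (f : MvPolynomial (Fin v) S) : Prop :=
  ∀ x : Fin v → S, MvPolynomial.eval x (C.gatePoly C.output) = MvPolynomial.eval x f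

/-- A sequence of polynomials over `S`.  The sequence is meant to be indexed by `n ≥ 1`: none of
the notions below looks at its entry with index `0`. -/
structure PolyFamily (S : Type) [CommSemiring S] : Type where
  numVars : ℕ → ℕ
  poly : (n : ℕ) → MvPolynomial (Fin (numVars n)) S

/-- A `p`-family: the number of variables and the degree are polynomially bounded. -/
def PolyFamily.IsPFamily {S : Type} [CommSemiring S] (f : PolyFamily S) : Prop :=
  ∃ a b : Polynomial ℕ, ∀ n : ℕ, 1 ≤ n →
    f.numVars n ≤ a.eval n ∧ (f.poly n).totalDegree ≤ b.eval n

/-- `VP`: the `p`-families that have circuits of polynomial size. -/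
def VP (S : Type) [CommSemiring S] : Set (PolyFamily S) :=
  {f | f.IsPFamily ∧ ∃ s : Polynomial ℕ, ∀ n : ℕ, 1 ≤ n →
    ∃ C : Circuit S (f.numVars n), C.size ≤ s.eval n ∧ C.Computes (f.poly n)}

/-- The value in `S` of a Boolean: `true` is the multiplicative and `false` the additive identity
(over the min-plus semirings: `0` and `∞`, respectively). -/
def boolVal (S : Type) [CommSemiring S] (b : Bool) : S := if b then 1 else 0

/-- The values given to the variables `X`, `y_1, …, y_q` and `ȳ_1, …, ȳ_(min r q)` by a point `x`
and a point `y` of the hypercube. -/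
def hypercubePoint {S : Type} [CommSemiring S] {v q : ℕ} (r : ℕ) (x : Fin v → S)
    (y : Fin q → Bool) : Fin v ⊕ Fin q ⊕ Fin (min r q) → S :=
  Sum.elim x (Sum.elim (fun j => boolVal S (y j))
    (fun j => boolVal S (!(y (Fin.castLE (min_le_right r q) j)))))

/-- `VNP^[r(n)]`: the `p`-families `f` for which there are `g ∈ VP` and polynomials `p`, `q` such
that, as functions of `X`, `f_n(X)` is the sum over all `y ∈ {0_S, 1_S} ^ q(n)` of
`g_(p(n)) (X, y_1, …, y_q(n), ȳ_1, …, ȳ_r(n))`; if `r(n) > q(n)`, all `q(n)` hypercube variables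
may be complemented.  The bijection `e` says which variable of `g_(p(n))` plays which role. -/
def VNP (S : Type) [CommSemiring S] (r : ℕ → ℕ) : Set (PolyFamily S) :=
  {f | f.IsPFamily ∧ ∃ g ∈ VP S, ∃ p q : Polynomial ℕ, ∀ n : ℕ, 1 ≤ n → 1 ≤ p.eval n ∧
    ∃ e : Fin (g.numVars (p.eval n)) ≃
        Fin (f.numVars n) ⊕ Fin (q.eval n) ⊕ Fin (min (r n) (q.eval n)),
      ∀ x : Fin (f.numVars n) → S,
        MvPolynomial.eval x (f.poly n) =
          ∑ y : Fin (q.eval n) → Bool,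
            MvPolynomial.eval (fun i => hypercubePoint (r n) x y (e i)) (g.poly (p.eval n))}

/-- The permanent of the `k × k` matrix of variables `x_(i,j)`. -/
noncomputable def permPoly (S : Type) [CommSemiring S] (k : ℕ) : MvPolynomial (Fin (k * k)) S :=
  ∑ σ : Equiv.Perm (Fin k), ∏ i : Fin k, MvPolynomial.X (finProdFinEquiv (i, σ i))

/-- The family `n ↦ perm_(β(n))`. -/
noncomputable def permFamily (S : Type) [CommSemiring S] (β : ℕ → ℕ) : PolyFamily S where
  numVars n := β n * β n
  poly n := permPoly S (β n)

/-!
Everything is proved for commutative semirings with idempotent addition, ordered by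
`a ≤ b ↔ a + b = b`, in which sums are suprema and polynomials define monotone functions.

**Few complemented variables.** A hypercube variable that occurs only uncomplemented may be set to
`1`, the larger of its two values, without changing the sum. So only the assignments to the
complemented variables have to be enumerated; there are at most `2 ^ r n` of them, polynomially many
if `r n = O(log n)` (`exists_circuit_hypercube_sum`, `VP_eq_VNP_of_isBigO`).

**Upper bound for the permanent.** With `L = log₂ n + 1`, divide the rows of a `k × k` matrix,
`k = D L`, into `D` blocks of `L` rows. A permutation assigns each column to the block of the row
matched with it, and conversely the permanent is the sum, over all assignments of columns to blocks,
of the product of the rectangular permanents of the blocks. An assignment is written in unary with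
`k D` hypercube variables and read off with their complements (`sum_eval_blockPerm`). The permanent
of one block is computed by dynamic programming over its `2 ^ L ≤ 2 n` sets of rows (`matchSum`,
`exists_circuit_blockPerm`). Hence `k D = D² L` complemented variables suffice, and if
`r n = ω(log n)` then `D → ∞` is possible (`blockCount`, `tendsto_blockCount`).

**Lower bound for the permanent.** A polynomial that defines the same function as the permanent has
all permutation monomials, and each of its monomials is divisible by one of them; this is seen by
evaluation at points with entries `0`, `1` and a cost `ω`
(`Circuit.two_pow_le_size_pow_of_computes_perm`). The support of a sum or a product is determined by
the supports of the operands since nothing cancels. Every permutation monomial therefore has a part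
of degree in `(k/3, 2k/3]` in the support of some gate, together with a context that completes it
(`Circuit.exists_gate_of_degree`). Permutations that meet at a gate can exchange contexts, so their
parts lie in the same `d` rows and the same `d` columns; at most `d! (k - d)! ≤ k! / 2 ^ (k/3)`
permutations can do this (`Circuit.two_pow_le_size_pow_of_support`). So a circuit of size `s` has
`2 ^ k ≤ s ^ 3`, and as `2 ^ k ≥ n ^ D` with `D → ∞`, no polynomial bounds `s`.
-/

/-! ### Monomials along a circuit, and the count of permutations -/

section GatePoly

variable {S : Type} [CommSemiring S] {v : ℕ} (C : Circuit S v) {i : Fin C.size}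

theorem Circuit.gatePoly_const {c : S} (h : C.gate i = .const c) :
    C.gatePoly i = MvPolynomial.C c := by
  rw [Circuit.gatePoly, h]

theorem Circuit.gatePoly_var {a : Fin v} (h : C.gate i = .var a) :
    C.gatePoly i = MvPolynomial.X a := by
  rw [Circuit.gatePoly, h]

theorem Circuit.gatePoly_add {j k : Fin i.val} (h : C.gate i = .add j k) :
    C.gatePoly i = C.gatePoly ⟨j.val, j.isLt.trans i.isLt⟩ +
      C.gatePoly ⟨k.val, k.isLt.trans i.isLt⟩ := by
  rw [Circuit.gatePoly, h]

theorem Circuit.gatePoly_mul {j k : Fin i.val} (h : C.gate i = .mul j k) :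
    C.gatePoly i = C.gatePoly ⟨j.val, j.isLt.trans i.isLt⟩ *
      C.gatePoly ⟨k.val, k.isLt.trans i.isLt⟩ := by
  rw [Circuit.gatePoly, h]

end GatePoly

section Support

variable {S : Type} [IdemCommSemiring S]

theorem MvPolynomial.mem_support_add_iff {ι : Type*} (p q : MvPolynomial ι S) (m : ι →₀ ℕ) :
    m ∈ (p + q).support ↔ m ∈ p.support ∨ m ∈ q.support := by
  simp only [MvPolynomial.mem_support_iff, MvPolynomial.coeff_add, ne_eq, add_eq_zero]
  tauto

theorem MvPolynomial.mem_support_mul_iff [NoZeroDivisors S] {ι : Type*} (p q : MvPolynomial ι S)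
    (m : ι →₀ ℕ) :
    m ∈ (p * q).support ↔ ∃ a ∈ p.support, ∃ b ∈ q.support, a + b = m := by
  classical
  simp only [MvPolynomial.mem_support_iff, MvPolynomial.coeff_mul, ne_eq,
    Finset.sum_eq_zero_iff, mul_eq_zero, not_forall, not_or, Prod.exists]
  constructor
  · rintro ⟨a, b, h, ha, hb⟩
    exact ⟨a, ha, b, hb, Finset.HasAntidiagonal.mem_antidiagonal.1 h⟩
  · rintro ⟨a, ha, b, hb, h⟩
    exact ⟨a, b, Finset.HasAntidiagonal.mem_antidiagonal.2 h, ha, hb⟩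

/-- Descending from a gate, always into a factor of larger degree, a monomial of degree more than
`2k/3` reaches a gate where its remaining part has degree in `(k/3, 2k/3]`. The part split off on
the way is a context: it turns every monomial of the gate reached into one of the gate left. -/
theorem Circuit.exists_gate_of_degree [NoZeroDivisors S] [Nontrivial S] {v : ℕ} (C : Circuit S v)
    {k : ℕ} (hk : 2 ≤ k) (i : Fin C.size) (m : Fin v →₀ ℕ) (hm : m ∈ (C.gatePoly i).support)
    (hdeg : 2 * k < 3 * m.degree) :
    ∃ j : Fin C.size, ∃ a ∈ (C.gatePoly j).support, ∃ b, a + b = m ∧ k < 3 * a.degree ∧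
      3 * a.degree ≤ 2 * k ∧ ∀ u ∈ (C.gatePoly j).support, u + b ∈ (C.gatePoly i).support := by
  obtain ⟨n, hn⟩ := i
  induction n using Nat.strong_induction_on generalizing m with
  | _ n ih =>
  cases h : C.gate ⟨n, hn⟩ with
  | const c =>
    rw [C.gatePoly_const h] at hm
    have : m = 0 := by
      by_contra hne
      simp [MvPolynomial.coeff_C, Ne.symm hne] at hm
    simp [this] at hdeg
  | var a =>
    rw [C.gatePoly_var h, MvPolynomial.support_X, Finset.mem_singleton] at hm
    rw [hm, Finsupp.degree_single] at hdeg
    omega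
  | add j l =>
    rw [C.gatePoly_add h] at hm ⊢
    rcases (MvPolynomial.mem_support_add_iff _ _ _).1 hm with hm | hm
    · obtain ⟨g, a, ha, b, hab, h1, h2, h3⟩ := ih j j.isLt m hdeg _ hm
      exact ⟨g, a, ha, b, hab, h1, h2, fun u hu =>
        (MvPolynomial.mem_support_add_iff _ _ _).2 (Or.inl (h3 u hu))⟩
    · obtain ⟨g, a, ha, b, hab, h1, h2, h3⟩ := ih l l.isLt m hdeg _ hm
      exact ⟨g, a, ha, b, hab, h1, h2, fun u hu =>
        (MvPolynomial.mem_support_add_iff _ _ _).2 (Or.inr (h3 u hu))⟩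
  | mul j l =>
    rw [C.gatePoly_mul h] at hm ⊢
    -- The step into a factor `c` of degree at least that of the cofactor `d`.
    have key : ∀ (x : Fin n) (Q : MvPolynomial (Fin v) S) (c d : Fin v →₀ ℕ),
        c ∈ (C.gatePoly ⟨x, x.isLt.trans hn⟩).support → d ∈ Q.support → c + d = m →
        d.degree ≤ c.degree →
        ∃ g : Fin C.size, ∃ a ∈ (C.gatePoly g).support, ∃ b, a + b = m ∧ k < 3 * a.degree ∧
          3 * a.degree ≤ 2 * k ∧ ∀ u ∈ (C.gatePoly g).support,
            u + b ∈ (C.gatePoly ⟨x, x.isLt.trans hn⟩ * Q).support := by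
      intro x Q c d hc hd hcd hle
      have hdm : c.degree + d.degree = m.degree := by rw [← hcd, map_add]
      rcases Nat.lt_or_ge (2 * k) (3 * c.degree) with hlt | hge
      · obtain ⟨g, a, ha, b, hab, h1, h2, h3⟩ := ih x x.isLt c hlt _ hc
        refine ⟨g, a, ha, b + d, by rw [← add_assoc, hab, hcd], h1, h2, fun u hu => ?_⟩
        exact (MvPolynomial.mem_support_mul_iff _ _ _).2
          ⟨u + b, h3 u hu, d, hd, add_assoc _ _ _⟩
      · exact ⟨_, c, hc, d, hcd, by omega, hge, fun u hu =>
          (MvPolynomial.mem_support_mul_iff _ _ _).2 ⟨u, hu, d, hd, rfl⟩⟩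
    obtain ⟨c, hc, d, hd, hcd⟩ := (MvPolynomial.mem_support_mul_iff _ _ _).1 hm
    rcases le_total d.degree c.degree with hle | hle
    · exact key j _ c d hc hd hcd hle
    · rw [mul_comm (C.gatePoly _)]
      exact key l _ d c hd hc ((add_comm d c).trans hcd) hle

end Support

section Counting

open Finset

theorem two_pow_mul_factorial_mul_factorial_le {t d e : ℕ} (hd : t ≤ d) (he : t ≤ e) :
    2 ^ t * (d.factorial * e.factorial) ≤ (d + e).factorial := by
  have key : ∀ d e : ℕ, d ≤ e → 2 ^ d * (d.factorial * e.factorial) ≤ (d + e).factorial := by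
    intro d e hde
    induction d with
    | zero => simp
    | succ d ih =>
      calc 2 ^ (d + 1) * ((d + 1).factorial * e.factorial)
          = (2 * (d + 1)) * (2 ^ d * (d.factorial * e.factorial)) := by
            rw [Nat.factorial_succ]; ring
        _ ≤ (d + e + 1) * (d + e).factorial := Nat.mul_le_mul (by omega) (ih (by omega))
        _ = (d + 1 + e).factorial := by
            rw [← Nat.factorial_succ]; congr 1; omega
  rcases le_total d e with h | h
  · exact (Nat.mul_le_mul_right _ (Nat.pow_le_pow_right (by norm_num) hd)).trans (key d e h)
  · rw [mul_comm d.factorial, add_comm]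
    exact (Nat.mul_le_mul_right _ (Nat.pow_le_pow_right (by norm_num) he)).trans (key e d h)

/-- A permutation mapping `I` onto `J` restricts to bijections `I ≃ J` and `Iᶜ ≃ Jᶜ`. -/
theorem card_perm_map_le {k : ℕ} (I J : Finset (Fin k)) :
    #{σ : Equiv.Perm (Fin k) | ∀ i, i ∈ I ↔ σ i ∈ J} ≤
      (#I).factorial * (k - #I).factorial := by
  classical
  rcases Finset.eq_empty_or_nonempty {σ : Equiv.Perm (Fin k) | ∀ i, i ∈ I ↔ σ i ∈ J} with h | h
  · simp [h]
  obtain ⟨σ₀, h₀⟩ := h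
  simp only [mem_filter, mem_univ, true_and] at h₀
  have h₀' : ∀ i, i ∉ I ↔ σ₀ i ∉ J := fun i => not_congr (h₀ i)
  rw [← Fintype.card_subtype]
  let F : {σ : Equiv.Perm (Fin k) // ∀ i, i ∈ I ↔ σ i ∈ J} →
      ({i // i ∈ I} ≃ {j // j ∈ J}) × ({i // i ∉ I} ≃ {j // j ∉ J}) := fun σ =>
    (σ.1.subtypeEquiv σ.2, σ.1.subtypeEquiv fun i => not_congr (σ.2 i))
  have hF : Function.Injective F := by
    intro σ τ h
    ext i
    have h' := Prod.ext_iff.1 h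
    by_cases hi : i ∈ I
    · simpa [F] using congrArg (fun e => ((e ⟨i, hi⟩ : {j // j ∈ J}) : Fin k).val) h'.1
    · simpa [F] using congrArg (fun e => ((e ⟨i, hi⟩ : {j // j ∉ J}) : Fin k).val) h'.2
  refine (Fintype.card_le_of_injective F hF).trans_eq ?_
  rw [Fintype.card_prod, Fintype.card_equiv (σ₀.subtypeEquiv h₀),
    Fintype.card_equiv (σ₀.subtypeEquiv h₀')]
  simp [Fintype.card_subtype_compl]

end Counting

section PermMonomial

variable {k : ℕ}

/-- The exponent vector of the monomial `∏ x_(i, σ i)` of the permanent. -/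
noncomputable def permMonomial (σ : Equiv.Perm (Fin k)) : Fin (k * k) →₀ ℕ :=
  ∑ i : Fin k, Finsupp.single (finProdFinEquiv (i, σ i)) 1

theorem permMonomial_apply (σ : Equiv.Perm (Fin k)) (i j : Fin k) :
    permMonomial σ (finProdFinEquiv (i, j)) = if σ i = j then 1 else 0 := by
  simp only [permMonomial, Finsupp.finsetSum_apply, Finsupp.single_apply,
    EmbeddingLike.apply_eq_iff_eq, Prod.mk.injEq]
  rw [Finset.sum_eq_single i] <;> simp +contextual

theorem degree_permMonomial (σ : Equiv.Perm (Fin k)) : (permMonomial σ).degree = k := by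
  simp [permMonomial]

/-- The degree of a monomial in the variables of row `i`. -/
def rowDegree (m : Fin (k * k) →₀ ℕ) (i : Fin k) : ℕ := ∑ j : Fin k, m (finProdFinEquiv (i, j))

/-- The degree of a monomial in the variables of column `j`. -/
def colDegree (m : Fin (k * k) →₀ ℕ) (j : Fin k) : ℕ := ∑ i : Fin k, m (finProdFinEquiv (i, j))

theorem rowDegree_add (a b : Fin (k * k) →₀ ℕ) (i : Fin k) :
    rowDegree (a + b) i = rowDegree a i + rowDegree b i := by
  simp [rowDegree, Finset.sum_add_distrib]

theorem colDegree_add (a b : Fin (k * k) →₀ ℕ) (i : Fin k) :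
    colDegree (a + b) i = colDegree a i + colDegree b i := by
  simp [colDegree, Finset.sum_add_distrib]

theorem rowDegree_permMonomial (σ : Equiv.Perm (Fin k)) (i : Fin k) :
    rowDegree (permMonomial σ) i = 1 := by
  simp [rowDegree, permMonomial_apply]

theorem colDegree_permMonomial (σ : Equiv.Perm (Fin k)) (j : Fin k) :
    colDegree (permMonomial σ) j = 1 := by
  simp only [colDegree, permMonomial_apply]
  rw [Finset.sum_eq_single (σ.symm j)]
  · simp
  · intro b _ hb
    rw [if_neg]
    rintro rfl
    simp at hb
  · simp

theorem sum_rowDegree (m : Fin (k * k) →₀ ℕ) : ∑ i, rowDegree m i = m.degree := by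
  rw [Finsupp.degree_eq_sum, ← Equiv.sum_comp finProdFinEquiv, Fintype.sum_prod_type]
  rfl

theorem apply_eq_zero_of_le_permMonomial {σ : Equiv.Perm (Fin k)} {m : Fin (k * k) →₀ ℕ}
    (h : m ≤ permMonomial σ) {i j : Fin k} (hij : σ i ≠ j) : m (finProdFinEquiv (i, j)) = 0 := by
  have := h (finProdFinEquiv (i, j))
  rw [permMonomial_apply, if_neg hij] at this
  omega

/-- Row `i` and column `σ i` share the only variable of theirs that may occur in a divisor of the
monomial of `σ`. -/
theorem rowDegree_eq_colDegree {σ : Equiv.Perm (Fin k)} {m : Fin (k * k) →₀ ℕ}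
    (h : m ≤ permMonomial σ) (i : Fin k) : rowDegree m i = colDegree m (σ i) := by
  rw [rowDegree, colDegree, Finset.sum_eq_single (σ i), Finset.sum_eq_single i]
  · intro b _ hb
    exact apply_eq_zero_of_le_permMonomial h fun h' => hb (σ.injective h')
  · simp
  · intro b _ hb
    exact apply_eq_zero_of_le_permMonomial h hb.symm
  · simp

theorem eq_permMonomial_of_le {σ : Equiv.Perm (Fin k)} {m : Fin (k * k) →₀ ℕ}
    (h : permMonomial σ ≤ m) (hm : m.degree ≤ k) : m = permMonomial σ := by
  obtain ⟨c, rfl⟩ := exists_add_of_le h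
  rw [map_add, degree_permMonomial] at hm
  have : c = 0 := (Finsupp.degree_eq_zero_iff c).1 (by omega)
  simp [this]

end PermMonomial

section LowerBound

open Finset

variable {S : Type} [IdemCommSemiring S] [NoZeroDivisors S] [Nontrivial S] {k : ℕ}

/-- The counting form of the lower bound. Two permutations that reach the same gate can exchange
their contexts, which forces the monomials there to occupy the same rows and the same columns;
hence few permutations share a gate. -/
theorem Circuit.two_pow_le_size_pow_of_support (C : Circuit S (k * k)) (hk : 2 ≤ k)
    (hge : ∀ m ∈ (C.gatePoly C.output).support, ∃ σ : Equiv.Perm (Fin k), permMonomial σ ≤ m)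
    (hmem : ∀ σ : Equiv.Perm (Fin k), permMonomial σ ∈ (C.gatePoly C.output).support) :
    2 ^ k ≤ C.size ^ 3 := by
  classical
  choose G a ha b hab h1 h2 h3 using fun σ : Equiv.Perm (Fin k) =>
    C.exists_gate_of_degree hk C.output (permMonomial σ) (hmem σ)
      (by rw [degree_permMonomial]; omega)
  have hdeg : ∀ σ, (a σ).degree + (b σ).degree = k := fun σ => by
    rw [← map_add, hab, degree_permMonomial]
  have hale : ∀ σ, a σ ≤ permMonomial σ := fun σ => by rw [← hab σ]; exact le_self_add
  -- Exchanging contexts gives two monomials of the output whose degrees add up to `2k`.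
  have hswap : ∀ σ τ, G σ = G τ → ∃ ρ, a σ + b τ = permMonomial ρ := by
    intro σ τ hG
    have hστ := h3 τ (a σ) (hG ▸ ha σ)
    have hτσ := h3 σ (a τ) (hG ▸ ha τ)
    obtain ⟨ρ, hρ⟩ := hge _ hστ
    obtain ⟨ρ', hρ'⟩ := hge _ hτσ
    have e := Finsupp.degree_mono hρ'
    rw [map_add, degree_permMonomial] at e
    refine ⟨ρ, eq_permMonomial_of_le hρ ?_⟩
    rw [map_add]
    have := hdeg σ
    have := hdeg τ
    omega
  have hrow : ∀ σ τ, G σ = G τ → ∀ i, rowDegree (a σ) i = rowDegree (a τ) i := by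
    intro σ τ hG i
    obtain ⟨ρ, hρ⟩ := hswap σ τ hG
    have e1 := congrArg (rowDegree · i) hρ
    have e2 := congrArg (rowDegree · i) (hab τ)
    simp only [rowDegree_add, rowDegree_permMonomial] at e1 e2
    omega
  have hcol : ∀ σ τ, G σ = G τ → ∀ i, colDegree (a σ) i = colDegree (a τ) i := by
    intro σ τ hG i
    obtain ⟨ρ, hρ⟩ := hswap σ τ hG
    have e1 := congrArg (colDegree · i) hρ
    have e2 := congrArg (colDegree · i) (hab τ)
    simp only [colDegree_add, colDegree_permMonomial] at e1 e2
    omega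
  -- `t` is `k / 3` rounded up.
  obtain ⟨t, ht1, ht2⟩ : ∃ t, k ≤ 3 * t ∧ 3 * t ≤ k + 2 := ⟨(k + 2) / 3, by omega, by omega⟩
  have hfiber : ∀ g : Fin C.size, 2 ^ t * #{σ | G σ = g} ≤ k.factorial := by
    intro g
    rcases Finset.eq_empty_or_nonempty {σ | G σ = g} with h | ⟨τ, hτ⟩
    · simp [h]
    simp only [mem_filter, mem_univ, true_and] at hτ
    set I : Finset (Fin k) := {i | rowDegree (a τ) i = 1} with hI
    set J : Finset (Fin k) := {j | colDegree (a τ) j = 1} with hJ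
    have hsub : ({σ | G σ = g} : Finset (Equiv.Perm (Fin k))) ⊆
        ({σ | ∀ i, i ∈ I ↔ σ i ∈ J} : Finset (Equiv.Perm (Fin k))) := by
      intro σ hσ
      simp only [mem_filter, mem_univ, true_and] at hσ
      have hG : G σ = G τ := hσ.trans hτ.symm
      simp only [mem_filter, mem_univ, true_and, hI, hJ]
      intro i
      rw [← hrow σ τ hG, ← hcol σ τ hG, rowDegree_eq_colDegree (hale σ)]
    have hcard : #I = (a τ).degree := by
      rw [← sum_rowDegree, hI, card_filter]
      refine sum_congr rfl fun i _ => ?_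
      have e2 := congrArg (rowDegree · i) (hab τ)
      simp only [rowDegree_add, rowDegree_permMonomial] at e2
      split_ifs <;> omega
    have e1 := h1 τ
    have e2 := h2 τ
    have e3 := hdeg τ
    calc 2 ^ t * #{σ | G σ = g} ≤ 2 ^ t * ((#I).factorial * (k - #I).factorial) :=
          Nat.mul_le_mul_left _ ((card_le_card hsub).trans (card_perm_map_le I J))
      _ ≤ (#I + (k - #I)).factorial :=
          two_pow_mul_factorial_mul_factorial_le (by omega) (by omega)
      _ = k.factorial := by congr 1; omega
  have htotal : 2 ^ t * k.factorial ≤ C.size * k.factorial := by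
    calc 2 ^ t * k.factorial = ∑ g : Fin C.size, 2 ^ t * #{σ | G σ = g} := by
          rw [← mul_sum, ← card_eq_sum_card_fiberwise (fun _ _ => mem_coe.2 (mem_univ _)),
            card_univ, Fintype.card_perm, Fintype.card_fin]
      _ ≤ ∑ _g : Fin C.size, k.factorial := sum_le_sum fun g _ => hfiber g
      _ = C.size * k.factorial := by simp
  have hsize := Nat.le_of_mul_le_mul_right htotal k.factorial_pos
  calc 2 ^ k ≤ 2 ^ (t * 3) := Nat.pow_le_pow_right (by norm_num) (by omega)
    _ = (2 ^ t) ^ 3 := pow_mul _ _ _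
    _ ≤ C.size ^ 3 := Nat.pow_le_pow_left hsize 3

end LowerBound

/-! ### Circuits for the permanent have exponential size -/

section Tests

open Finset

variable {S : Type} [IdemCommSemiring S]

theorem Finset.sum_le_of_forall_le_of_idem {ι : Type*} {s : Finset ι} {f : ι → S} {c : S}
    (h : ∀ i ∈ s, f i ≤ c) : ∑ i ∈ s, f i ≤ c := by
  classical
  induction s using Finset.induction_on with
  | empty => simp
  | insert a s ha ih =>
    rw [sum_insert ha]
    exact add_le (h a (mem_insert_self _ _)) (ih fun i hi => h i (mem_insert_of_mem hi))

theorem eval_permPoly {R : Type} [CommSemiring R] {k : ℕ} (x : Fin (k * k) → R) :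
    MvPolynomial.eval x (permPoly R k) =
      ∑ σ : Equiv.Perm (Fin k), ∏ i, x (finProdFinEquiv (i, σ i)) := by
  simp [permPoly, map_sum, map_prod]

theorem le_eval_of_mem_support {ι : Type*} [Fintype ι] (P : MvPolynomial ι S) (x : ι → S)
    (m : ι →₀ ℕ) : P.coeff m * ∏ i, x i ^ m i ≤ MvPolynomial.eval x P := by
  by_cases hm : m ∈ P.support
  · rw [MvPolynomial.eval_eq']
    exact single_le_sum (f := fun m => P.coeff m * ∏ i, x i ^ m i) (fun _ _ => zero_le) hm
  · simp [MvPolynomial.notMem_support_iff.1 hm]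

/-- If `S` has an element `ω` of positive finite cost, circuits for the permanent have exponential
size. Evaluations at suitable points with entries `0`, `1`, `ω` show that a polynomial defining the
same function as the permanent has every permutation monomial, and only multiples of them. -/
theorem Circuit.two_pow_le_size_pow_of_computes_perm [NoZeroDivisors S] [Nontrivial S] {k : ℕ}
    {ω : S} (hω₁ : ω ≤ 1) (hω : ∀ n : ℕ, ¬ ω ^ n ≤ ω ^ (n + 1)) (hk : 2 ≤ k)
    (C : Circuit S (k * k)) (hC : C.Computes (permPoly S k)) : 2 ^ k ≤ C.size ^ 3 := by
  classical
  set P := C.gatePoly C.output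
  have heval : ∀ x : Fin (k * k) → S, MvPolynomial.eval x P =
      ∑ σ : Equiv.Perm (Fin k), ∏ i, x (finProdFinEquiv (i, σ i)) := fun x => by
    rw [← eval_permPoly]; exact hC x
  have hcoeff : ∀ m, P.coeff m ≤ 1 := by
    intro m
    have h := le_eval_of_mem_support P (fun _ => 1) m
    rw [heval] at h
    simp only [one_pow, prod_const_one, mul_one] at h
    exact h.trans (sum_le_of_forall_le_of_idem fun _ _ => le_rfl)
  have hge : ∀ m ∈ P.support, ∃ σ : Equiv.Perm (Fin k), permMonomial σ ≤ m := by
    intro m hm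
    have h := le_eval_of_mem_support P (fun p => if m p = 0 then 0 else 1) m
    have h1 : ∏ p, (if m p = 0 then (0 : S) else 1) ^ m p = 1 :=
      prod_eq_one fun p _ => by by_cases hp : m p = 0 <;> simp [hp]
    rw [h1, mul_one, heval] at h
    have hne : ∑ σ : Equiv.Perm (Fin k),
        ∏ i, (if m (finProdFinEquiv (i, σ i)) = 0 then (0 : S) else 1) ≠ 0 := by
      intro h0
      rw [h0] at h
      exact MvPolynomial.mem_support_iff.1 hm (le_antisymm h zero_le)
    obtain ⟨σ, -, hσ⟩ := exists_ne_zero_of_sum_ne_zero hne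
    refine ⟨σ, fun p => ?_⟩
    obtain ⟨⟨i, j⟩, rfl⟩ := finProdFinEquiv.surjective p
    rw [permMonomial_apply]
    split_ifs with hij
    · subst hij
      have := prod_ne_zero_iff.1 hσ i (mem_univ i)
      simp only [ne_eq, ite_eq_left_iff, one_ne_zero, imp_false, not_not] at this
      omega
    · exact Nat.zero_le _
  refine C.two_pow_le_size_pow_of_support hk hge fun σ => ?_
  by_contra hσ
  refine hω k ?_
  have hlow : ω ^ k ≤ MvPolynomial.eval (fun p => if permMonomial σ p = 0 then 0 else ω) P := by
    rw [heval]
    refine le_trans (le_of_eq ?_) (single_le_sum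
      (f := fun τ : Equiv.Perm (Fin k) => ∏ i,
        (if permMonomial σ (finProdFinEquiv (i, τ i)) = 0 then (0 : S) else ω))
      (fun _ _ => zero_le) (mem_univ σ))
    simp [permMonomial_apply]
  refine hlow.trans ?_
  rw [MvPolynomial.eval_eq']
  refine sum_le_of_forall_le_of_idem fun m hm => ?_
  by_cases hsub : ∀ p, permMonomial σ p = 0 → m p = 0
  · have hprod : ∏ p, (if permMonomial σ p = 0 then (0 : S) else ω) ^ m p = ω ^ m.degree := by
      rw [Finsupp.degree_eq_sum, ← prod_pow_eq_pow_sum]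
      refine prod_congr rfl fun p _ => ?_
      by_cases hp : permMonomial σ p = 0
      · simp [hsub p hp]
      · simp [hp]
    obtain ⟨ρ, hρ⟩ := hge m hm
    have hdeg : k + 1 ≤ m.degree := by
      by_contra hlt
      have hmρ := eq_permMonomial_of_le hρ (by omega)
      refine hσ ?_
      have : ρ = σ := by
        ext i
        by_contra hi
        have h0 := hsub (finProdFinEquiv (i, ρ i))
          (by rw [permMonomial_apply, if_neg fun h => hi (congrArg Fin.val h.symm)])
        rw [hmρ, permMonomial_apply, if_pos rfl] at h0
        exact one_ne_zero h0
      rw [← this, ← hmρ]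
      exact hm
    rw [hprod]
    calc P.coeff m * ω ^ m.degree ≤ 1 * ω ^ (k + 1) :=
          mul_le_mul' (hcoeff m) (pow_le_pow_right_of_le_one' hω₁ hdeg)
      _ = ω ^ (k + 1) := one_mul _
  · push Not at hsub
    obtain ⟨p, hp, hmp⟩ := hsub
    rw [prod_eq_zero (mem_univ p) (by simp [hp, hmp]), mul_zero]
    exact zero_le

end Tests

/-! ### Straight-line programs -/

section StraightLine

variable {S : Type} [CommSemiring S] {v : ℕ}

/-- A straight-line program: a list of polynomials, latest first, each of which is a constant, a
variable, or the sum or product of two earlier ones. -/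
inductive IsStraightLine : List (MvPolynomial (Fin v) S) → Prop
  | nil : IsStraightLine []
  | const {l : List (MvPolynomial (Fin v) S)} (h : IsStraightLine l) (c : S) :
      IsStraightLine (MvPolynomial.C c :: l)
  | var {l : List (MvPolynomial (Fin v) S)} (h : IsStraightLine l) (i : Fin v) :
      IsStraightLine (MvPolynomial.X i :: l)
  | add {l : List (MvPolynomial (Fin v) S)} (h : IsStraightLine l) {a b : MvPolynomial (Fin v) S}
      (ha : a ∈ l) (hb : b ∈ l) : IsStraightLine ((a + b) :: l)
  | mul {l : List (MvPolynomial (Fin v) S)} (h : IsStraightLine l) {a b : MvPolynomial (Fin v) S}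
      (ha : a ∈ l) (hb : b ∈ l) : IsStraightLine ((a * b) :: l)

theorem Circuit.gatePoly_eq_of_agree {C C' : Circuit S v} (hle : C.size ≤ C'.size)
    (h : ∀ i : Fin C.size, C'.gate (i.castLE hle) = C.gate i) (i : Fin C.size) :
    C'.gatePoly (i.castLE hle) = C.gatePoly i := by
  obtain ⟨n, hn⟩ := i
  induction n using Nat.strong_induction_on with
  | _ n ih =>
  have h' := h ⟨n, hn⟩
  cases hg : C.gate ⟨n, hn⟩ with
  | const c => rw [C.gatePoly_const hg, C'.gatePoly_const (h'.trans hg)]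
  | var a => rw [C.gatePoly_var hg, C'.gatePoly_var (h'.trans hg)]
  | add j k =>
    rw [C.gatePoly_add hg, C'.gatePoly_add (h'.trans hg)]
    exact congrArg₂ _ (ih j j.isLt _) (ih k k.isLt _)
  | mul j k =>
    rw [C.gatePoly_mul hg, C'.gatePoly_mul (h'.trans hg)]
    exact congrArg₂ _ (ih j j.isLt _) (ih k k.isLt _)

/-- Appending a gate to a sequence of gates. -/
theorem exists_circuit_snoc {n : ℕ} (gate : (i : Fin n) → Gate S v i.val) (G : Gate S v n) :
    ∃ gate' : (i : Fin (n + 1)) → Gate S v i.val,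
      gate' (Fin.last n) = G ∧
      ∀ (o : Fin (n + 1)) (o' i : Fin n),
        (Circuit.mk (n + 1) gate' o).gatePoly i.castSucc = (Circuit.mk n gate o').gatePoly i := by
  refine ⟨Fin.snoc (α := fun i : Fin (n + 1) => Gate S v i.val) gate G, Fin.snoc_last _ _, ?_⟩
  intro o o' i
  exact Circuit.gatePoly_eq_of_agree (C := ⟨n, gate, o'⟩)
    (C' := ⟨n + 1, Fin.snoc (α := fun i : Fin (n + 1) => Gate S v i.val) gate G, o⟩)
    (Nat.le_succ n)
    (fun i => Fin.snoc_castSucc (α := fun i : Fin (n + 1) => Gate S v i.val) _ _ i) i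

/-- The polynomials of a straight-line program are those at the gates of a circuit of the same
length. The output of the circuit plays no role and is left open, as an empty program has none. -/
theorem IsStraightLine.exists_gates {l : List (MvPolynomial (Fin v) S)} (h : IsStraightLine l) :
    ∃ gate : (i : Fin l.length) → Gate S v i.val, ∀ a ∈ l, ∃ i : Fin l.length,
      ∀ o, (Circuit.mk l.length gate o).gatePoly i = a := by
  -- The new gate contributes its own polynomial; the earlier ones are unchanged.
  have step : ∀ (l : List (MvPolynomial (Fin v) S)) (p : MvPolynomial (Fin v) S)
      (gate : (i : Fin l.length) → Gate S v i.val),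
      (∀ a ∈ l, ∃ i : Fin l.length, ∀ o, (Circuit.mk l.length gate o).gatePoly i = a) →
      ∀ G : Gate S v l.length,
      (∀ (gate' : (i : Fin (l.length + 1)) → Gate S v i.val) (o : Fin (l.length + 1)),
        gate' (Fin.last _) = G →
        (∀ o' i : Fin l.length, (Circuit.mk (l.length + 1) gate' o).gatePoly i.castSucc =
          (Circuit.mk l.length gate o').gatePoly i) →
        (Circuit.mk (l.length + 1) gate' o).gatePoly (Fin.last _) = p) →
      ∃ gate : (i : Fin (p :: l).length) → Gate S v i.val, ∀ a ∈ p :: l,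
        ∃ i : Fin (p :: l).length,
          ∀ o, (Circuit.mk (p :: l).length gate o).gatePoly i = a := by
    intro l p gate hgate G hG
    obtain ⟨gate', hlast, hold⟩ := exists_circuit_snoc gate G
    refine ⟨gate', fun a ha => ?_⟩
    rcases List.mem_cons.1 ha with rfl | ha
    · exact ⟨Fin.last _, fun o => hG gate' o hlast fun o' i => hold o o' i⟩
    · obtain ⟨i, hi⟩ := hgate a ha
      exact ⟨i.castSucc, fun o => (hold o i i).trans (hi i)⟩
  induction h with
  | nil => exact ⟨fun i => i.elim0, fun a ha => absurd ha List.not_mem_nil⟩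
  | @const l _ c ih =>
    obtain ⟨gate, hgate⟩ := ih
    exact step l _ gate hgate (.const c) fun gate' o h _ => Circuit.gatePoly_const _ h
  | @var l _ i ih =>
    obtain ⟨gate, hgate⟩ := ih
    exact step l _ gate hgate (.var i) fun gate' o h _ => Circuit.gatePoly_var _ h
  | @add l _ a b ha hb ih =>
    obtain ⟨gate, hgate⟩ := ih
    obtain ⟨i, hi⟩ := hgate a ha
    obtain ⟨j, hj⟩ := hgate b hb
    refine step l _ gate hgate (.add i j) fun gate' o h hold => ?_
    rw [Circuit.gatePoly_add _ h, ← hi i, ← hj i, ← hold i i, ← hold i j]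
    rfl
  | @mul l _ a b ha hb ih =>
    obtain ⟨gate, hgate⟩ := ih
    obtain ⟨i, hi⟩ := hgate a ha
    obtain ⟨j, hj⟩ := hgate b hb
    refine step l _ gate hgate (.mul i j) fun gate' o h hold => ?_
    rw [Circuit.gatePoly_mul _ h, ← hi i, ← hj i, ← hold i i, ← hold i j]
    rfl

/-- `Reach T s U`: every straight-line program that contains the polynomials in `T` can be prolonged
by at most `s` further gates to one that contains those in `U` as well. -/
def Reach (T : Set (MvPolynomial (Fin v) S)) (s : ℕ) (U : Set (MvPolynomial (Fin v) S)) : Prop :=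
  ∀ l, IsStraightLine l → (∀ a ∈ T, a ∈ l) →
    ∃ l', IsStraightLine l' ∧ (∀ a ∈ l, a ∈ l') ∧ (∀ a ∈ U, a ∈ l') ∧
      l'.length ≤ l.length + s

namespace Reach

variable {T T' U U' W : Set (MvPolynomial (Fin v) S)} {s s' : ℕ}

theorem exists_circuit {p : MvPolynomial (Fin v) S} (h : Reach ∅ s {p}) :
    ∃ C : Circuit S v, C.size ≤ s ∧ C.gatePoly C.output = p := by
  obtain ⟨l, hl, -, hp, hlen⟩ := h [] IsStraightLine.nil (by simp)
  obtain ⟨gate, hgate⟩ := hl.exists_gates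
  obtain ⟨i, hi⟩ := hgate p (hp p rfl)
  exact ⟨⟨l.length, gate, i⟩, by simpa using hlen, hi i⟩

theorem mono (h : Reach T s U) (hT : T ⊆ T') (hs : s ≤ s') (hU : U' ⊆ U) : Reach T' s' U' := by
  intro l hl hTl
  obtain ⟨l', h1, h2, h3, h4⟩ := h l hl fun a ha => hTl a (hT ha)
  exact ⟨l', h1, h2, fun a ha => h3 a (hU ha), by omega⟩

theorem of_subset (h : U ⊆ T) : Reach T 0 U := fun l hl hTl =>
  ⟨l, hl, fun _ ha => ha, fun a ha => hTl a (h ha), le_rfl⟩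

theorem trans (h : Reach T s U) (h' : Reach (T ∪ U) s' W) : Reach T (s + s') W := by
  intro l hl hTl
  obtain ⟨l', h1, h2, h3, h4⟩ := h l hl hTl
  obtain ⟨l'', k1, k2, k3, k4⟩ := h' l' h1 fun a ha => ha.elim (fun ha => h2 a (hTl a ha)) (h3 a)
  exact ⟨l'', k1, fun a ha => k2 a (h2 a ha), k3, by omega⟩

theorem union (h : Reach T s U) (h' : Reach T s' W) : Reach T (s + s') (U ∪ W) := by
  intro l hl hTl
  obtain ⟨l', h1, h2, h3, h4⟩ := h l hl hTl
  obtain ⟨l'', k1, k2, k3, k4⟩ := h' l' h1 fun a ha => h2 a (hTl a ha)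
  exact ⟨l'', k1, fun a ha => k2 a (h2 a ha), fun a ha => ha.elim (fun ha => k2 a (h3 a ha)) (k3 a),
    by omega⟩

theorem range {ι : Type*} [Fintype ι] (f : ι → MvPolynomial (Fin v) S)
    (h : ∀ i, Reach T s {f i}) : Reach T (Fintype.card ι * s) (Set.range f) := by
  classical
  have key : ∀ F : Finset ι, Reach T (F.card * s) (f '' F) := by
    intro F
    induction F using Finset.induction_on with
    | empty => simpa using of_subset (Set.empty_subset T)
    | insert a F ha ih =>
      refine (ih.union (h a)).mono subset_rfl ?_ ?_
      · rw [Finset.card_insert_of_notMem ha, add_one_mul]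
      · rw [Finset.coe_insert, Set.image_insert_eq]
        exact fun x hx => hx.symm
  simpa using key Finset.univ

theorem const (c : S) : Reach T 1 {MvPolynomial.C c} := fun l hl _ =>
  ⟨_, hl.const c, fun _ => List.mem_cons_of_mem _, by simp, le_rfl⟩

theorem zero : Reach T 1 {0} := by simpa using const (T := T) 0

theorem one : Reach T 1 {1} := by simpa using const (T := T) 1

theorem var (i : Fin v) : Reach T 1 {MvPolynomial.X i} := fun l hl _ =>
  ⟨_, hl.var i, fun _ => List.mem_cons_of_mem _, by simp, le_rfl⟩

theorem add {a b : MvPolynomial (Fin v) S} (ha : a ∈ T) (hb : b ∈ T) : Reach T 1 {a + b} :=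
  fun l hl h => ⟨_, hl.add (h a ha) (h b hb), fun _ => List.mem_cons_of_mem _, by simp, le_rfl⟩

theorem mul {a b : MvPolynomial (Fin v) S} (ha : a ∈ T) (hb : b ∈ T) : Reach T 1 {a * b} :=
  fun l hl h => ⟨_, hl.mul (h a ha) (h b hb), fun _ => List.mem_cons_of_mem _, by simp, le_rfl⟩

theorem sum {ι : Type*} (F : Finset ι) (f : ι → MvPolynomial (Fin v) S)
    (h : ∀ i ∈ F, f i ∈ T) : Reach T (F.card + 1) {∑ i ∈ F, f i} := by
  classical
  induction F using Finset.induction_on with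
  | empty => simpa using zero
  | insert a F ha ih =>
    rw [Finset.sum_insert ha, Finset.card_insert_of_notMem ha]
    exact (ih fun i hi => h i (Finset.mem_insert_of_mem hi)).trans
      (add (Or.inl (h a (Finset.mem_insert_self _ _))) (Or.inr rfl))

theorem prod {ι : Type*} (F : Finset ι) (f : ι → MvPolynomial (Fin v) S)
    (h : ∀ i ∈ F, f i ∈ T) : Reach T (F.card + 1) {∏ i ∈ F, f i} := by
  classical
  induction F using Finset.induction_on with
  | empty => simpa using one
  | insert a F ha ih =>
    rw [Finset.prod_insert ha, Finset.card_insert_of_notMem ha]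
    exact (ih fun i hi => h i (Finset.mem_insert_of_mem hi)).trans
      (mul (Or.inl (h a (Finset.mem_insert_self _ _))) (Or.inr rfl))

/-- Substituting polynomials that are available already costs one gate for each gate. -/
theorem bind₁ {w : ℕ} (C : Circuit S w) (φ : Fin w → MvPolynomial (Fin v) S)
    (hφ : ∀ i, φ i ∈ T) :
    Reach T C.size {MvPolynomial.bind₁ φ (C.gatePoly C.output)} := by
  have key : ∀ n (hn : n ≤ C.size), Reach T n
      {a | ∃ i : Fin C.size, i.val < n ∧ a = MvPolynomial.bind₁ φ (C.gatePoly i)} := by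
    intro n
    induction n with
    | zero => exact fun _ => of_subset (by rintro a ⟨i, hi, -⟩; omega)
    | succ n ih =>
      intro hn
      set V := {a | ∃ i : Fin C.size, i.val < n ∧ a = MvPolynomial.bind₁ φ (C.gatePoly i)}
      have hnew : Reach (T ∪ V) 1 {MvPolynomial.bind₁ φ (C.gatePoly ⟨n, hn⟩)} := by
        cases hg : C.gate ⟨n, hn⟩ with
        | const c =>
          rw [C.gatePoly_const hg, MvPolynomial.bind₁_C_right]
          exact const c
        | var a =>
          rw [C.gatePoly_var hg, MvPolynomial.bind₁_X_right]
          exact (of_subset (by simpa using Or.inl (hφ a))).mono subset_rfl zero_le_one subset_rfl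
        | add j k =>
          rw [C.gatePoly_add hg, map_add]
          exact add (Or.inr ⟨_, j.isLt, rfl⟩) (Or.inr ⟨_, k.isLt, rfl⟩)
        | mul j k =>
          rw [C.gatePoly_mul hg, map_mul]
          exact mul (Or.inr ⟨_, j.isLt, rfl⟩) (Or.inr ⟨_, k.isLt, rfl⟩)
      refine ((ih (by omega)).trans ((of_subset Set.subset_union_right).union hnew)).mono
        subset_rfl (by omega) ?_
      rintro a ⟨i, hi, rfl⟩
      rcases Nat.lt_succ_iff_lt_or_eq.1 hi with hi | rfl
      · exact Or.inl ⟨i, hi, rfl⟩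
      · exact Or.inr rfl
  exact (key C.size le_rfl).mono subset_rfl le_rfl (by rintro a rfl; exact ⟨_, C.output.isLt, rfl⟩)

end Reach

end StraightLine

/-! ### Logarithmically many complemented variables -/

section LogarithmicallyMany

open Finset

/-- A family in `VP` is its own hypercube sum over no variables. -/
theorem VP_subset_VNP (S : Type) [CommSemiring S] (r : ℕ → ℕ) : VP S ⊆ VNP S r := by
  intro f hf
  refine ⟨hf.1, f, hf, Polynomial.X, 0, fun n hn => ?_⟩
  rw [Polynomial.eval_X, Polynomial.eval_zero]
  have : IsEmpty (Fin (min (r n) 0)) := by rw [Nat.min_zero]; infer_instance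
  refine ⟨hn, (Equiv.sumEmpty (Fin (f.numVars n)) (Fin 0 ⊕ Fin (min (r n) 0))).symm, fun x => ?_⟩
  rw [Fintype.sum_unique]
  rfl

theorem eval_mono_of_idem {S : Type} [IdemCommSemiring S] {ι : Type*} [Fintype ι]
    (P : MvPolynomial ι S) {x x' : ι → S} (h : ∀ i, x i ≤ x' i) :
    MvPolynomial.eval x P ≤ MvPolynomial.eval x' P := by
  rw [MvPolynomial.eval_eq', MvPolynomial.eval_eq']
  exact sum_le_sum fun m _ => mul_le_mul_right
    (prod_le_prod' fun i _ => pow_le_pow_left' (h i) (m i)) _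

/-- Hypercube variables that occur uncomplemented only may be set to `1`, the largest of the two
values; only the complemented ones have to be enumerated. -/
theorem exists_circuit_hypercube_sum {S : Type} [IdemCommSemiring S] {r v Q w : ℕ}
    (e : Fin w → Fin v ⊕ Fin Q ⊕ Fin (min r Q)) {P : MvPolynomial (Fin w) S} (G : Circuit S w)
    (hG : G.Computes P) :
    ∃ C : Circuit S v, C.size ≤ v + 2 + (2 ^ r * G.size + (2 ^ r + 1)) ∧ ∀ x : Fin v → S,
      MvPolynomial.eval x (C.gatePoly C.output) =
        ∑ y : Fin Q → Bool, MvPolynomial.eval (fun i => hypercubePoint r x y (e i)) P := by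
  -- The hypercube point whose complemented coordinates are given by `z`.
  let ext : (Fin (min r Q) → Bool) → Fin Q → Bool := fun z j =>
    if h : j.val < min r Q then z ⟨j, h⟩ else true
  let φ : (Fin (min r Q) → Bool) → Fin v ⊕ Fin Q ⊕ Fin (min r Q) →
      MvPolynomial (Fin v) S := fun z =>
    Sum.elim MvPolynomial.X (Sum.elim (fun j => MvPolynomial.C (boolVal S (ext z j)))
      (fun j => MvPolynomial.C (boolVal S (!(z j)))))
  set T : Set (MvPolynomial (Fin v) S) := Set.range MvPolynomial.X ∪ ({0} ∪ {1})
  have hbool : ∀ c : Bool, MvPolynomial.C (boolVal S c) ∈ T := by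
    intro c
    cases c
    · exact Or.inr (Or.inl (by simp [boolVal]))
    · exact Or.inr (Or.inr (by simp [boolVal]))
  have hφ : ∀ z i, φ z i ∈ T := by
    rintro z (i | j | j)
    · exact Or.inl ⟨i, rfl⟩
    · exact hbool _
    · exact hbool _
  have h0 : Reach (∅ : Set (MvPolynomial (Fin v) S)) (v * 1 + (1 + 1)) T := by
    have := Reach.range (T := ∅) (fun i : Fin v => (MvPolynomial.X i : MvPolynomial (Fin v) S))
      fun i => Reach.var i
    rw [Fintype.card_fin] at this
    exact this.union (Reach.zero.union Reach.one)
  have h1 : Reach (∅ ∪ T) (2 ^ min r Q * G.size) (Set.range fun z : Fin (min r Q) → Bool =>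
      MvPolynomial.bind₁ (fun i => φ z (e i)) (G.gatePoly G.output)) := by
    have := Reach.range (T := ∅ ∪ T) (fun z : Fin (min r Q) → Bool =>
      MvPolynomial.bind₁ (fun i => φ z (e i)) (G.gatePoly G.output))
      fun z => Reach.bind₁ G _ fun i => Or.inr (hφ z (e i))
    simpa using this
  have h2 := h0.trans (h1.trans (Reach.sum (univ : Finset (Fin (min r Q) → Bool)) (fun z =>
      MvPolynomial.bind₁ (fun i => φ z (e i)) (G.gatePoly G.output))
      fun z _ => Or.inr ⟨z, rfl⟩))
  obtain ⟨C, hCsize, hC⟩ := h2.exists_circuit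
  refine ⟨C, hCsize.trans ?_, fun x => ?_⟩
  · have hcard : #(univ : Finset (Fin (min r Q) → Bool)) = 2 ^ min r Q := by simp
    have h2m : 2 ^ min r Q ≤ 2 ^ r := Nat.pow_le_pow_right (by norm_num) (min_le_left _ _)
    rw [hcard]
    have := Nat.mul_le_mul_right G.size h2m
    omega
  · have hpoint : ∀ z : Fin (min r Q) → Bool,
        MvPolynomial.eval x (MvPolynomial.bind₁ (fun i => φ z (e i)) (G.gatePoly G.output)) =
          MvPolynomial.eval (fun i => hypercubePoint r x (ext z) (e i)) P := by
      intro z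
      rw [← hG, MvPolynomial.eval, MvPolynomial.eval₂Hom_bind₁]
      congr 2
      funext i
      generalize e i = j
      rcases j with j | j | j
      · simp [φ, hypercubePoint]
      · simp [φ, hypercubePoint]
      · have hj : ext z (Fin.castLE (min_le_right r Q) j) = z j := dif_pos j.isLt
        simp [φ, hypercubePoint, hj]
    rw [hC, map_sum]
    simp only [hpoint]
    refine le_antisymm (sum_le_of_forall_le_of_idem fun z _ => ?_)
      (sum_le_of_forall_le_of_idem fun y _ => ?_)
    · exact single_le_sum (f := fun y : Fin Q → Bool =>
        MvPolynomial.eval (fun i => hypercubePoint r x y (e i)) P)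
        (fun _ _ => zero_le) (mem_univ (ext z))
    · refine le_trans (eval_mono_of_idem _ fun i => ?_) (single_le_sum
        (f := fun z : Fin (min r Q) → Bool =>
          MvPolynomial.eval (fun i => hypercubePoint r x (ext z) (e i)) P)
        (fun _ _ => zero_le)
        (mem_univ fun j : Fin (min r Q) => y (Fin.castLE (min_le_right r Q) j)))
      generalize e i = j
      rcases j with j | j | j
      · exact le_rfl
      · change boolVal S (y j) ≤ boolVal S (ext (fun j => y (Fin.castLE (min_le_right r Q) j)) j)
        by_cases hj : j.val < min r Q
        · have h1 : ext (fun j => y (Fin.castLE (min_le_right r Q) j)) j = y j := dif_pos hj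
          rw [h1]
        · have h1 : ext (fun j => y (Fin.castLE (min_le_right r Q) j)) j = true := dif_neg hj
          rw [h1]
          cases y j
          · exact zero_le
          · exact le_rfl
      · have h1 : ext (fun j => y (Fin.castLE (min_le_right r Q) j))
            (Fin.castLE (min_le_right r Q) j) = y (Fin.castLE (min_le_right r Q) j) :=
          dif_pos j.isLt
        simp [hypercubePoint, h1]

theorem VNP_subset_VP_of_two_pow_le {S : Type} [IdemCommSemiring S] {r : ℕ → ℕ}
    (t : Polynomial ℕ) (ht : ∀ n, 1 ≤ n → 2 ^ r n ≤ t.eval n) : VNP S r ⊆ VP S := by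
  rintro f ⟨⟨a, b, hab⟩, g, ⟨-, s, hs⟩, p, q, hpq⟩
  refine ⟨⟨a, b, hab⟩, a + 2 + (t * s.comp p + (t + 1)), fun n hn => ?_⟩
  obtain ⟨hp, e, he⟩ := hpq n hn
  obtain ⟨G, hGsize, hG⟩ := hs (p.eval n) hp
  obtain ⟨C, hCsize, hC⟩ := exists_circuit_hypercube_sum e G hG
  refine ⟨C, hCsize.trans ?_, fun x => (hC x).trans (he x).symm⟩
  simp only [Polynomial.eval_add, Polynomial.eval_mul, Polynomial.eval_comp,
    Polynomial.eval_ofNat, Polynomial.eval_one]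
  have h1 := ht n hn
  have h2 := (hab n hn).1
  have h3 := Nat.mul_le_mul h1 hGsize
  omega

theorem exists_polynomial_two_pow_le {r : ℕ → ℕ}
    (h : (fun n : ℕ => (r n : ℝ)) =O[Filter.atTop] (fun n : ℕ => Real.log (n : ℝ))) :
    ∃ t : Polynomial ℕ, ∀ n, 1 ≤ n → 2 ^ r n ≤ t.eval n := by
  obtain ⟨c, hc⟩ := h.bound
  obtain ⟨N, hN⟩ := Filter.eventually_atTop.1 hc
  refine ⟨Polynomial.X ^ ⌈c⌉₊ + Polynomial.C (∑ i ∈ range N, 2 ^ r i), fun n hn => ?_⟩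
  simp only [Polynomial.eval_add, Polynomial.eval_pow, Polynomial.eval_X, Polynomial.eval_C]
  rcases Nat.lt_or_ge n N with hlt | hge
  · exact (single_le_sum (f := fun i => 2 ^ r i) (fun _ _ => Nat.zero_le _)
      (mem_range.2 hlt)).trans (Nat.le_add_left _ _)
  · refine le_trans ?_ (Nat.le_add_right _ _)
    have hpos : (0 : ℝ) < n := by exact_mod_cast hn
    have hlog : 0 ≤ Real.log n := Real.log_nonneg (by exact_mod_cast hn)
    have h1 := hN n hge
    rw [Real.norm_of_nonneg (Nat.cast_nonneg _), Real.norm_of_nonneg hlog] at h1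
    have h2 : (r n : ℝ) * Real.log 2 ≤ ⌈c⌉₊ * Real.log n := by
      calc (r n : ℝ) * Real.log 2 ≤ r n * 1 :=
            mul_le_mul_of_nonneg_left (by linarith [Real.log_two_lt_d9]) (Nat.cast_nonneg _)
        _ ≤ c * Real.log n := by rwa [mul_one]
        _ ≤ ⌈c⌉₊ * Real.log n := mul_le_mul_of_nonneg_right (Nat.le_ceil c) hlog
    rw [← Real.log_pow, ← Real.log_pow] at h2
    have h3 := (Real.log_le_log_iff (by positivity) (by positivity)).1 h2
    exact_mod_cast h3

end LogarithmicallyMany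

/-! ### Rectangular permanents by dynamic programming -/

section Matchings

open Finset

variable {A : Type*} [CommSemiring A] {R K : Type*} [Fintype R] [DecidableEq R]

/-- Dynamic programming over the columns: `matchSum w l T` is the sum, over the injective maps from
the set of rows `T` to the columns in `l`, of the products of the corresponding entries of `w`. -/
def matchSum (w : R → K → A) : List K → Finset R → A
  | [], T => if T = ∅ then 1 else 0
  | j :: l, T => matchSum w l T + ∑ i ∈ T, w i j * matchSum w l (T.erase i)

/-- The injective maps from the rows in `T` to the columns in `l`, encoded as functions to
`Option K` with value `none` exactly outside `T`. -/
def partialInj [Fintype K] [DecidableEq K] (l : List K) (T : Finset R) : Finset (R → Option K) :=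
  {τ | (∀ i, τ i = none ↔ i ∉ T) ∧ (∀ i, ∀ j, τ i = some j → j ∈ l) ∧
    ∀ i i' j, τ i = some j → τ i' = some j → i = i'}

theorem matchSum_eq_sum_partialInj [Fintype K] [DecidableEq K] (w : R → K → A) {l : List K}
    (hl : l.Nodup) (T : Finset R) :
    matchSum w l T = ∑ τ ∈ partialInj l T, ∏ i, (τ i).elim 1 (w i) := by
  induction l generalizing T with
  | nil =>
    rw [matchSum]
    split_ifs with hT
    · have : partialInj (K := K) [] T = {fun _ => none} := by
        ext τ
        simp only [partialInj, mem_filter, mem_univ, true_and, mem_singleton, hT, notMem_empty,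
          not_false_eq_true, iff_true]
        constructor
        · rintro ⟨h, -, -⟩
          exact funext h
        · rintro rfl
          simp
      simp [this]
    · have : partialInj (K := K) [] T = ∅ := by
        obtain ⟨i, hi⟩ := Finset.nonempty_iff_ne_empty.2 hT
        refine Finset.eq_empty_of_forall_notMem fun τ hτ => ?_
        simp only [partialInj, mem_filter, mem_univ, true_and] at hτ
        obtain ⟨h1, h2, -⟩ := hτ
        cases h : τ i with
        | none => exact (h1 i).1 h hi
        | some j => exact List.not_mem_nil (h2 i j h)
      simp [this]
  | cons j l ih =>
    rw [List.nodup_cons] at hl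
    rw [matchSum, ← sum_filter_not_add_sum_filter (partialInj (j :: l) T)
      (fun τ => ∃ i, τ i = some j)]
    congr 1
    · rw [ih hl.2]
      refine sum_congr ?_ fun _ _ => rfl
      ext τ
      simp only [partialInj, mem_filter, mem_univ, true_and, List.mem_cons, not_exists]
      constructor
      · rintro ⟨h1, h2, h3⟩
        exact ⟨⟨h1, fun i j' h => Or.inr (h2 i j' h), h3⟩, fun i h => hl.1 (h2 i j h)⟩
      · rintro ⟨⟨h1, h2, h3⟩, h4⟩
        refine ⟨h1, fun i j' h => (h2 i j' h).resolve_left ?_, h3⟩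
        rintro rfl
        exact h4 i h
    · simp only [ih hl.2, mul_sum]
      rw [sum_sigma']
      -- The row matched to the new column `j` is adjoined.
      refine sum_bij (fun p _ => Function.update p.2 p.1 (some j)) ?_ ?_ ?_ ?_
      · rintro ⟨i, τ⟩ h
        simp only [partialInj, mem_sigma, mem_filter, mem_univ, true_and, mem_erase,
          List.mem_cons] at h ⊢
        obtain ⟨hi, h1, h2, h3⟩ := h
        have hj : ∀ i', τ i' ≠ some j := fun i' h => hl.1 (h2 i' j h)
        refine ⟨⟨fun i' => ?_, fun i' j' => ?_, fun i₁ i₂ j' => ?_⟩, i, Function.update_self ..⟩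
        · rcases eq_or_ne i' i with rfl | hne
          · simp [hi]
          · simp [h1, hne]
        · rcases eq_or_ne i' i with rfl | hne
          · rw [Function.update_self, Option.some_inj]
            exact fun h => Or.inl h.symm
          · rw [Function.update_of_ne hne]
            exact fun h => Or.inr (h2 i' j' h)
        · rcases eq_or_ne i₁ i with rfl | hne₁
          · rcases eq_or_ne i₂ i₁ with rfl | hne₂
            · exact fun _ _ => rfl
            · rw [Function.update_self, Function.update_of_ne hne₂]
              exact fun h h' => absurd (h'.trans h.symm) (hj i₂)
          · rcases eq_or_ne i₂ i with rfl | hne₂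
            · rw [Function.update_self, Function.update_of_ne hne₁]
              exact fun h h' => absurd (h.trans h'.symm) (hj i₁)
            · rw [Function.update_of_ne hne₁, Function.update_of_ne hne₂]
              exact h3 i₁ i₂ j'
      · rintro ⟨i, τ⟩ h ⟨i', τ'⟩ h' heq
        simp only [partialInj, mem_sigma, mem_filter, mem_univ, true_and, mem_erase] at h h'
        have hj : ∀ i', τ' i' ≠ some j := fun i' e => hl.1 (h'.2.2.1 i' j e)
        have hii : i = i' := by
          by_contra hne
          have := congrFun heq i
          simp only [Function.update_self, Function.update_of_ne hne] at this
          exact hj i this.symm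
        subst hii
        have : τ = τ' := by
          funext i'
          rcases eq_or_ne i' i with rfl | hne
          · rw [(h.2.1 i').2 (by simp), (h'.2.1 i').2 (by simp)]
          · have := congrFun heq i'
            simpa only [Function.update_of_ne hne] using this
        rw [this]
      · intro τ h
        simp only [partialInj, mem_filter, mem_univ, true_and, List.mem_cons] at h
        obtain ⟨⟨h1, h2, h3⟩, i, hi⟩ := h
        have hiT : i ∈ T := by
          by_contra h
          rw [(h1 i).2 h] at hi
          exact absurd hi (by simp)
        refine ⟨⟨i, Function.update τ i none⟩, ?_, by simp [← hi]⟩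
        simp only [partialInj, mem_sigma, mem_filter, mem_univ, true_and, mem_erase]
        refine ⟨hiT, fun i' => ?_, fun i' j' h => ?_, fun i₁ i₂ j' h h' => ?_⟩
        · rcases eq_or_ne i' i with rfl | hne
          · simp
          · simp [h1, hne]
        · rcases eq_or_ne i' i with rfl | hne
          · simp at h
          · rw [Function.update_of_ne hne] at h
            refine (h2 i' j' h).resolve_left ?_
            rintro rfl
            exact hne (h3 _ _ _ h hi)
        · rcases eq_or_ne i₁ i with rfl | hne₁
          · simp at h
          · rcases eq_or_ne i₂ i with rfl | hne₂
            · simp at h'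
            · rw [Function.update_of_ne hne₁] at h
              rw [Function.update_of_ne hne₂] at h'
              exact h3 _ _ _ h h'
      · rintro ⟨i, τ⟩ h
        simp only [partialInj, mem_sigma, mem_filter, mem_univ, true_and, mem_erase] at h
        have hi : τ i = none := (h.2.1 i).2 (by simp)
        rw [← mul_prod_erase univ (fun i' => (Function.update τ i (some j) i').elim 1 (w i'))
          (mem_univ i), ← mul_prod_erase univ (fun i' => (τ i').elim 1 (w i')) (mem_univ i)]
        simp only [hi, Option.elim_none, one_mul, Function.update_self, Option.elim_some]
        congr 1
        refine prod_congr rfl fun i' hi' => ?_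
        rw [Function.update_of_ne (ne_of_mem_erase hi')]

/-- On the set of all rows the dynamic program computes the rectangular permanent. -/
theorem matchSum_univ [Fintype K] [DecidableEq K] (w : R → K → A) {l : List K}
    (hl : l.Nodup) (hmem : ∀ j, j ∈ l) :
    matchSum w l univ = ∑ τ : R → K with Function.Injective τ, ∏ i, w i (τ i) := by
  rw [matchSum_eq_sum_partialInj w hl]
  symm
  refine sum_bij (fun τ _ i => some (τ i)) ?_ ?_ ?_ ?_
  · intro τ hτ
    simp only [mem_filter, mem_univ, true_and] at hτ
    simp only [partialInj, mem_filter, mem_univ, true_and, Option.some_inj]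
    exact ⟨by simp, fun _ _ _ => hmem _, fun i i' j h h' => hτ (h.trans h'.symm)⟩
  · intro τ _ τ' _ h
    exact funext fun i => Option.some_inj.1 (congrFun h i)
  · intro τ hτ
    simp only [partialInj, mem_filter, mem_univ, true_and, not_true_eq_false, iff_false] at hτ
    choose τ' hτ' using fun i => Option.ne_none_iff_exists'.1 (hτ.1 i)
    refine ⟨τ', ?_, funext fun i => (hτ' i).symm⟩
    simp only [mem_filter, mem_univ, true_and]
    intro i i' h
    exact hτ.2.2 i i' (τ' i) (hτ' i) (by rw [h]; exact hτ' i')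
  · intro τ _
    rfl

/-- All values of the dynamic program are computed with a number of gates that is exponential only
in the number of rows. -/
theorem Reach.range_matchSum {S : Type} [CommSemiring S] {v : ℕ} {T : Set (MvPolynomial (Fin v) S)}
    (w : R → K → MvPolynomial (Fin v) S) (hw : ∀ i j, w i j ∈ T) (l : List K) :
    Reach T (2 + l.length * (2 ^ Fintype.card R * (2 * Fintype.card R + 2)))
      (Set.range (matchSum w l)) := by
  induction l with
  | nil =>
    refine (Reach.zero.union Reach.one).mono subset_rfl (by omega) ?_
    rintro _ ⟨F, rfl⟩
    rw [matchSum]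
    split_ifs
    · exact Or.inr rfl
    · exact Or.inl rfl
  | cons j l ih =>
    have hstep : ∀ F : Finset R, Reach (T ∪ Set.range (matchSum w l))
        (2 * Fintype.card R + 2) {matchSum w (j :: l) F} := by
      intro F
      have h1 := Reach.range (T := T ∪ Set.range (matchSum w l))
        (fun i : R => w i j * matchSum w l (F.erase i))
        fun i => Reach.mul (Or.inl (hw i j)) (Or.inr ⟨_, rfl⟩)
      have h2 := h1.trans (((Reach.of_subset (Set.singleton_subset_iff.2
        (Or.inl (Or.inr ⟨F, rfl⟩)))).union (Reach.sum F
          (fun i : R => w i j * matchSum w l (F.erase i)) fun i _ => Or.inr ⟨i, rfl⟩)).trans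
            (Reach.add (Or.inr (Or.inl rfl)) (Or.inr (Or.inr rfl))))
      refine h2.mono subset_rfl ?_ (by rw [matchSum])
      have := card_le_univ F
      omega
    have h3 := Reach.range (fun F => matchSum w (j :: l) F) hstep
    rw [Fintype.card_finset] at h3
    refine (ih.trans h3).mono subset_rfl (le_of_eq ?_) subset_rfl
    rw [List.length_cons]
    ring

end Matchings

/-! ### The permanent as a hypercube sum over block permanents -/

section BlockPermanent

open Finset

/-- The variables `X`, `y`, `ȳ` listed one after the other. -/
def tripleEquiv (a q m : ℕ) : Fin (a + (q + m)) ≃ Fin a ⊕ Fin q ⊕ Fin m :=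
  finSumFinEquiv.symm.trans (Equiv.sumCongr (Equiv.refl _) finSumFinEquiv.symm)

variable {D L q r : ℕ}

/-- The index of the complementable hypercube variable that says whether column `j` may be used by
block `B`. -/
def selectorIndex (h : D * L * D ≤ min r q) (j : Fin (D * L)) (B : Fin D) : Fin (min r q) :=
  Fin.castLE h (finProdFinEquiv (j, B))

/-- The `(i, j)` entry of the rows of block `B`: the matrix variable times a selector, which is `1`
if the variables `y_(j, ·)` single out the block `B`, and `0` otherwise. -/
noncomputable def blockEntry (S : Type) [CommSemiring S] (h : D * L * D ≤ min r q) (B : Fin D)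
    (i : Fin L) (j : Fin (D * L)) :
    MvPolynomial (Fin (D * L * (D * L) + (q + min r q))) S :=
  MvPolynomial.X ((tripleEquiv _ _ _).symm
      (Sum.inl (finProdFinEquiv (finProdFinEquiv (B, i), j)))) *
    (MvPolynomial.X ((tripleEquiv _ _ _).symm
        (Sum.inr (Sum.inl (Fin.castLE (min_le_right r q) (selectorIndex h j B))))) *
      ∏ B' ∈ univ.erase B, MvPolynomial.X ((tripleEquiv _ _ _).symm
        (Sum.inr (Sum.inr (selectorIndex h j B')))))

/-- The product over `D` blocks of `L` rows of the rectangular permanents of the blocks, where the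
hypercube variables assign each column to at most one block. -/
noncomputable def blockPerm (S : Type) [CommSemiring S] (h : D * L * D ≤ min r q) :
    MvPolynomial (Fin (D * L * (D * L) + (q + min r q))) S :=
  ∏ B : Fin D, ∑ τ : Fin L → Fin (D * L) with Function.Injective τ, ∏ i, blockEntry S h B i (τ i)

theorem totalDegree_blockPerm_le {S : Type} [CommSemiring S] [Nontrivial S]
    (h : D * L * D ≤ min r q) : (blockPerm S h).totalDegree ≤ D * (L * (D + 2)) := by
  have hentry : ∀ B i j, (blockEntry S h B i j).totalDegree ≤ D + 2 := by
    intro B i j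
    have hprod : (∏ B' ∈ univ.erase B, (MvPolynomial.X ((tripleEquiv _ _ _).symm
        (Sum.inr (Sum.inr (selectorIndex h j B')))) :
          MvPolynomial (Fin (D * L * (D * L) + (q + min r q))) S)).totalDegree ≤ D := by
      refine (MvPolynomial.totalDegree_finsetProd _ _).trans ?_
      simp only [MvPolynomial.totalDegree_X, sum_const, smul_eq_mul, mul_one]
      exact (card_le_univ _).trans_eq (Fintype.card_fin D)
    have h1 := (MvPolynomial.totalDegree_mul _ _).trans
      (add_le_add (MvPolynomial.totalDegree_X (R := S) ((tripleEquiv _ _ _).symm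
        (Sum.inr (Sum.inl (Fin.castLE (min_le_right r q) (selectorIndex h j B)))))).le hprod)
    have h2 := (MvPolynomial.totalDegree_mul _ _).trans
      (add_le_add (MvPolynomial.totalDegree_X (R := S) ((tripleEquiv _ _ _).symm
        (Sum.inl (finProdFinEquiv (finProdFinEquiv (B, i), j))))).le h1)
    exact h2.trans (by omega)
  refine (MvPolynomial.totalDegree_finsetProd _ _).trans
    ((sum_le_card_nsmul _ _ (L * (D + 2)) fun B _ => ?_).trans_eq (by simp))
  refine MvPolynomial.totalDegree_finsetSum_le fun τ _ => ?_
  exact (MvPolynomial.totalDegree_finsetProd _ _).trans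
    ((sum_le_card_nsmul _ _ (D + 2) fun i _ => hentry B i (τ i)).trans_eq (by simp))

/-- The variables, the entries of the blocks, the permanents of the blocks and their product are
computed in turn. -/
theorem exists_circuit_blockPerm {S : Type} [CommSemiring S] (h : D * L * D ≤ min r q) :
    ∃ C : Circuit S (D * L * (D * L) + (q + min r q)),
      C.size ≤ (D * L * (D * L) + (q + min r q)) + (D * (L * (D * L)) * (D + 3) +
        (D * (2 + D * L * (2 ^ L * (2 * L + 2))) + (D + 1))) ∧
      C.gatePoly C.output = blockPerm S h := by
  have h0 := Reach.range (T := ∅)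
    (fun i : Fin (D * L * (D * L) + (q + min r q)) => (MvPolynomial.X i : MvPolynomial _ S))
    fun i => Reach.var i
  have h1 := Reach.range (T := ∅ ∪ Set.range fun i : Fin (D * L * (D * L) + (q + min r q)) =>
      (MvPolynomial.X i : MvPolynomial _ S)) (s := D + 3)
    (fun p : Fin D × Fin L × Fin (D * L) => blockEntry S h p.1 p.2.1 p.2.2) (by
      rintro ⟨B, i, j⟩
      refine ((Reach.prod (univ.erase B) (fun B' => MvPolynomial.X ((tripleEquiv _ _ _).symm
        (Sum.inr (Sum.inr (selectorIndex h j B'))))) fun B' _ => Or.inr ⟨_, rfl⟩).trans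
          ((Reach.mul (Or.inl (Or.inr ⟨_, rfl⟩)) (Or.inr rfl)).trans
            (Reach.mul (Or.inl (Or.inl (Or.inr ⟨_, rfl⟩))) (Or.inr rfl)))).mono
          subset_rfl ?_ subset_rfl
      have := (card_le_univ (univ.erase B)).trans_eq (Fintype.card_fin D)
      omega)
  have h2 := h0.trans (h1.trans ((Reach.range
    (fun B : Fin D => matchSum (blockEntry S h B) (List.finRange (D * L)) univ)
    fun B => (Reach.range_matchSum (blockEntry S h B) (fun i j => Or.inr ⟨(B, i, j), rfl⟩)
      (List.finRange (D * L))).mono subset_rfl le_rfl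
        (Set.singleton_subset_iff.2 ⟨univ, rfl⟩)).trans
    (Reach.prod univ (fun B : Fin D => matchSum (blockEntry S h B) (List.finRange (D * L)) univ)
      fun B _ => Or.inr ⟨B, rfl⟩)))
  obtain ⟨C, hsize, hC⟩ := h2.exists_circuit
  refine ⟨C, by simpa using hsize, hC.trans (prod_congr rfl fun B _ => ?_)⟩
  exact matchSum_univ _ (List.nodup_finRange _) (List.mem_finRange)

theorem eval_blockPerm {S : Type} [CommSemiring S] (h : D * L * D ≤ min r q)
    (x : Fin (D * L * (D * L)) → S) (y : Fin q → Bool) :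
    MvPolynomial.eval (fun i => hypercubePoint r x y (tripleEquiv _ _ _ i)) (blockPerm S h) =
      ∏ B : Fin D, ∑ τ : Fin L → Fin (D * L) with Function.Injective τ, ∏ i,
        x (finProdFinEquiv (finProdFinEquiv (B, i), τ i)) *
          (boolVal S (y (Fin.castLE (min_le_right r q) (selectorIndex h (τ i) B))) *
            ∏ B' ∈ univ.erase B,
              boolVal S (!(y (Fin.castLE (min_le_right r q) (selectorIndex h (τ i) B'))))) := by
  simp [blockPerm, blockEntry, hypercubePoint, map_prod, map_sum]

theorem prod_finProdFinEquiv {A : Type*} [CommMonoid A] (f : Fin (D * L) → A) :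
    ∏ B : Fin D, ∏ i : Fin L, f (finProdFinEquiv (B, i)) = ∏ p, f p := by
  rw [← Equiv.prod_comp finProdFinEquiv f, Fintype.prod_prod_type]

/-- A point of the hypercube that assigns each column to one block contributes the permutations
compatible with this assignment. At any other point some column is usable by no block, and the
contribution is zero because the blocks need all columns. -/
theorem sum_eval_blockPerm {S : Type} [IdemCommSemiring S] (h : D * L * D ≤ min r q)
    (x : Fin (D * L * (D * L)) → S) :
    ∑ y : Fin q → Bool,
        MvPolynomial.eval (fun i => hypercubePoint r x y (tripleEquiv _ _ _ i)) (blockPerm S h) =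
      MvPolynomial.eval x (permPoly S (D * L)) := by
  classical
  rw [eval_permPoly]
  simp only [eval_blockPerm]
  have hbool : ∀ c : Bool, boolVal S c ≤ 1 := by
    intro c
    cases c
    · exact zero_le
    · exact le_rfl
  refine le_antisymm (sum_le_of_forall_le_of_idem fun y _ => ?_)
    (sum_le_of_forall_le_of_idem fun σ _ => ?_)
  · rw [prod_univ_sum]
    refine sum_le_of_forall_le_of_idem fun τ hτ => ?_
    by_cases hsel : ∀ B i,
        y (Fin.castLE (min_le_right r q) (selectorIndex h (τ B i) B)) = true ∧
          ∀ B', B' ≠ B → y (Fin.castLE (min_le_right r q) (selectorIndex h (τ B i) B')) = false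
    · have hinj : Function.Injective fun p : Fin (D * L) =>
          τ (finProdFinEquiv.symm p).1 (finProdFinEquiv.symm p).2 := by
        intro p p' hpp
        obtain ⟨⟨B, i⟩, rfl⟩ := finProdFinEquiv.surjective p
        obtain ⟨⟨B', i'⟩, rfl⟩ := finProdFinEquiv.surjective p'
        simp only [Equiv.symm_apply_apply] at hpp
        have hBB : B = B' := by
          by_contra hne
          have h1 := (hsel B i).1
          rw [hpp, (hsel B' i').2 B hne] at h1
          exact Bool.false_ne_true h1
        subst hBB
        have := (mem_filter.1 (Fintype.mem_piFinset.1 hτ B)).2 hpp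
        rw [this]
      let σ := Equiv.ofBijective _ (Finite.injective_iff_bijective.1 hinj)
      calc _ ≤ ∏ B, ∏ i, x (finProdFinEquiv (finProdFinEquiv (B, i), τ B i)) :=
            prod_le_prod' fun B _ => prod_le_prod' fun i _ => by
              refine mul_le_of_le_one_right' ?_
              exact mul_le_one' (hbool _) (prod_le_one' fun _ _ => hbool _)
        _ = ∏ p, x (finProdFinEquiv (p, σ p)) := by
            rw [← prod_finProdFinEquiv]
            simp only [σ, Equiv.ofBijective_apply, Equiv.symm_apply_apply]
        _ ≤ _ := single_le_sum (f := fun σ : Equiv.Perm (Fin (D * L)) =>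
            ∏ p, x (finProdFinEquiv (p, σ p))) (fun _ _ => zero_le) (mem_univ σ)
    · -- Some selector vanishes, and the whole product with it.
      refine le_of_eq_of_le ?_ (zero_le)
      push Not at hsel
      obtain ⟨B, i, hBi⟩ := hsel
      refine prod_eq_zero (mem_univ B) (prod_eq_zero (mem_univ i) ?_)
      cases hy : y (Fin.castLE (min_le_right r q) (selectorIndex h (τ B i) B)) with
      | false => simp [boolVal]
      | true =>
        obtain ⟨B', hne, hB'⟩ := hBi hy
        rw [prod_eq_zero (mem_erase.2 ⟨hne, mem_univ B'⟩) (by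
          rw [ne_eq, Bool.not_eq_false] at hB'
          simp [hB', boolVal]), mul_zero, mul_zero]
  · -- The point of the hypercube that assigns the column `σ p` to the block of row `p`.
    have hpos : Function.Injective fun c : Fin (D * L) × Fin D =>
        Fin.castLE (min_le_right r q) (selectorIndex h c.1 c.2) := by
      rintro ⟨j, B⟩ ⟨j', B'⟩ hc
      simpa [selectorIndex] using hc
    obtain ⟨y, hy⟩ := hpos.surjective_comp_right
      (fun c : Fin (D * L) × Fin D => decide ((finProdFinEquiv.symm (σ.symm c.1)).1 = c.2))
    have hy' : ∀ j B, y (Fin.castLE (min_le_right r q) (selectorIndex h j B)) =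
        decide ((finProdFinEquiv.symm (σ.symm j)).1 = B) := fun j B => congrFun hy (j, B)
    refine le_trans ?_ (single_le_sum (f := fun y : Fin q → Bool =>
      ∏ B : Fin D, ∑ τ : Fin L → Fin (D * L) with Function.Injective τ, ∏ i,
        x (finProdFinEquiv (finProdFinEquiv (B, i), τ i)) *
          (boolVal S (y (Fin.castLE (min_le_right r q) (selectorIndex h (τ i) B))) *
            ∏ B' ∈ univ.erase B,
              boolVal S (!(y (Fin.castLE (min_le_right r q) (selectorIndex h (τ i) B'))))))
      (fun _ _ => zero_le) (mem_univ y))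
    rw [← prod_finProdFinEquiv]
    refine prod_le_prod' fun B _ => ?_
    refine le_trans (le_of_eq ?_) (single_le_sum (f := fun τ : Fin L → Fin (D * L) => ∏ i,
        x (finProdFinEquiv (finProdFinEquiv (B, i), τ i)) *
          (boolVal S (y (Fin.castLE (min_le_right r q) (selectorIndex h (τ i) B))) *
            ∏ B' ∈ univ.erase B,
              boolVal S (!(y (Fin.castLE (min_le_right r q) (selectorIndex h (τ i) B'))))))
      (fun _ _ => zero_le) (mem_filter.2 ⟨mem_univ fun i => σ (finProdFinEquiv (B, i)), ?_⟩))
    · refine prod_congr rfl fun i _ => ?_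
      rw [prod_eq_one, mul_one, hy']
      · simp [boolVal]
      · intro B' hB'
        rw [hy']
        simp [boolVal, (ne_of_mem_erase hB').symm]
    · intro i i' hii
      simpa using hii

end BlockPermanent

/-! ### Growth of the parameters, and the min-plus semirings -/

section Asymptotics

open Finset

theorem mul_le_of_mul_mul_le {D L n : ℕ} (h : D * L * D ≤ n) : D * L ≤ n := by
  rcases Nat.eq_zero_or_pos D with rfl | hD
  · simp
  · exact (Nat.le_mul_of_pos_right _ hD).trans h

theorem permFamily_isPFamily (S : Type) [CommSemiring S] [Nontrivial S] {β : ℕ → ℕ}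
    (hβ : ∀ n, 1 ≤ n → β n ≤ n) : (permFamily S β).IsPFamily := by
  refine ⟨Polynomial.X * Polynomial.X, Polynomial.X, fun n hn => ⟨?_, ?_⟩⟩
  · simpa [permFamily] using Nat.mul_le_mul (hβ n hn) (hβ n hn)
  · rw [Polynomial.eval_X]
    refine le_trans ?_ (hβ n hn)
    refine MvPolynomial.totalDegree_finsetSum_le fun σ _ => ?_
    refine (MvPolynomial.totalDegree_finsetProd _ _).trans ?_
    exact (sum_le_card_nsmul _ _ 1 fun i _ => (MvPolynomial.totalDegree_X _).le).trans_eq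
      (by simp)

theorem permFamily_mem_VNP {S : Type} [IdemCommSemiring S] [Nontrivial S] {r D : ℕ → ℕ}
    (hD : ∀ n, D n * (Nat.log 2 n + 1) * D n ≤ min (r n) n) :
    permFamily S (fun n => D n * (Nat.log 2 n + 1)) ∈ VNP S r := by
  have hk : ∀ n, D n * (Nat.log 2 n + 1) ≤ n := fun n =>
    mul_le_of_mul_mul_le ((hD n).trans (min_le_right _ _))
  have hDn : ∀ n, D n ≤ n := fun n => (Nat.le_mul_of_pos_right _ (Nat.succ_pos _)).trans (hk n)
  have hL : ∀ n, 1 ≤ n → Nat.log 2 n + 1 ≤ n := fun n hn => Nat.log_lt_self 2 (by omega)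
  refine ⟨permFamily_isPFamily S fun n _ => hk n,
    ⟨fun n => _, fun n => blockPerm S (hD n)⟩, ⟨?_, ?_⟩, Polynomial.X, Polynomial.X, fun n hn => ?_⟩
  · refine ⟨Polynomial.X * Polynomial.X + (Polynomial.X + Polynomial.X),
      Polynomial.X * (Polynomial.X * (Polynomial.X + 2)), fun n hn => ⟨?_, ?_⟩⟩
    · simp only [Polynomial.eval_add, Polynomial.eval_mul, Polynomial.eval_X]
      exact add_le_add (Nat.mul_le_mul (hk n) (hk n)) (Nat.add_le_add_left (min_le_right _ _) _)
    · simp only [Polynomial.eval_add, Polynomial.eval_mul, Polynomial.eval_X,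
        Polynomial.eval_ofNat]
      exact (totalDegree_blockPerm_le (hD n)).trans (Nat.mul_le_mul (hDn n)
        (Nat.mul_le_mul (hL n hn) (Nat.add_le_add_right (hDn n) 2)))
  · refine ⟨(Polynomial.X * Polynomial.X + (Polynomial.X + Polynomial.X)) +
      (Polynomial.X * (Polynomial.X * Polynomial.X) * (Polynomial.X + 3) +
      (Polynomial.X * (2 + Polynomial.X * (2 * Polynomial.X * (2 * Polynomial.X + 2))) +
        (Polynomial.X + 1))), fun n hn => ?_⟩
    obtain ⟨C, hsize, hC⟩ := exists_circuit_blockPerm (S := S) (hD n)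
    refine ⟨C, hsize.trans ?_, fun x => by rw [hC]⟩
    simp only [Polynomial.eval_add, Polynomial.eval_mul, Polynomial.eval_X, Polynomial.eval_ofNat,
      Polynomial.eval_one]
    -- A block has `log₂ n + 1` rows, hence at most `2 n` sets of rows.
    have hpow : 2 ^ (Nat.log 2 n + 1) ≤ 2 * n := by
      rw [pow_succ, mul_comm]
      exact Nat.mul_le_mul_left 2 (Nat.pow_log_le_self 2 (by omega))
    have h1 := hk n
    have h2 := hDn n
    have h3 := hL n hn
    have h4 : min (r n) n ≤ n := min_le_right _ _
    gcongr
  · rw [Polynomial.eval_X]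
    exact ⟨hn, tripleEquiv _ _ _, fun x => (sum_eval_blockPerm (hD n) x).symm⟩

theorem exists_eval_le_mul_pow (s : Polynomial ℕ) :
    ∃ K e : ℕ, ∀ n, 1 ≤ n → s.eval n ≤ K * n ^ e := by
  refine ⟨s.eval 1, s.natDegree, fun n hn => ?_⟩
  rw [Polynomial.eval_eq_sum_range, Polynomial.eval_eq_sum_range, sum_mul]
  refine sum_le_sum fun i hi => ?_
  rw [one_pow, mul_one]
  exact Nat.mul_le_mul_left _ (Nat.pow_le_pow_right hn (by have := mem_range.1 hi; omega))

/-- As `n < 2 ^ (log₂ n + 1)`, the lower bound `2 ^ (D n * (log₂ n + 1))` on the cube of the size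
exceeds `n ^ e` for every fixed `e`. -/
theorem permFamily_notMem_VP {S : Type} [IdemCommSemiring S] [NoZeroDivisors S] [Nontrivial S]
    {ω : S} (hω₁ : ω ≤ 1) (hω : ∀ n : ℕ, ¬ ω ^ n ≤ ω ^ (n + 1)) {D : ℕ → ℕ}
    (hD : Filter.Tendsto D Filter.atTop Filter.atTop) :
    permFamily S (fun n => D n * (Nat.log 2 n + 1)) ∉ VP S := by
  rintro ⟨-, s, hs⟩
  obtain ⟨K, e, hK⟩ := exists_eval_le_mul_pow (s ^ 3)
  obtain ⟨n, hn⟩ := ((hD.eventually_ge_atTop (e + 2)).and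
    (Filter.eventually_gt_atTop K)).exists
  have hn1 : 1 ≤ n := by omega
  obtain ⟨C, hsize, hC⟩ := hs n hn1
  have hk : 2 ≤ D n * (Nat.log 2 n + 1) :=
    (show 2 ≤ D n by omega).trans (Nat.le_mul_of_pos_right _ (Nat.succ_pos _))
  have hlow := C.two_pow_le_size_pow_of_computes_perm hω₁ hω hk hC
  have hup : C.size ^ 3 ≤ K * n ^ e := by
    refine le_trans (Nat.pow_le_pow_left hsize 3) ?_
    have := hK n hn1
    rwa [Polynomial.eval_pow] at this
  have hpow : n ^ (e + 1) ≤ 2 ^ (D n * (Nat.log 2 n + 1)) := by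
    calc n ^ (e + 1) ≤ n ^ D n := Nat.pow_le_pow_right hn1 (by omega)
      _ ≤ (2 ^ (Nat.log 2 n + 1)) ^ D n :=
        Nat.pow_le_pow_left (Nat.lt_pow_succ_log_self (by norm_num) n).le _
      _ = 2 ^ (D n * (Nat.log 2 n + 1)) := by rw [← pow_mul, mul_comm]
  have hlt : K * n ^ e < n ^ (e + 1) := by
    rw [pow_succ, mul_comm]
    exact Nat.mul_lt_mul_of_pos_left hn.2 (Nat.pow_pos hn1)
  omega

/-- The number of blocks: the square root of `min (r n) n / (log₂ n + 1)`. The minimum with `n`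
keeps the permanent a `p`-family when `r` grows fast. -/
def blockCount (r : ℕ → ℕ) (n : ℕ) : ℕ := Nat.sqrt (min (r n) n / (Nat.log 2 n + 1))

theorem blockCount_mul_le (r : ℕ → ℕ) (n : ℕ) :
    blockCount r n * (Nat.log 2 n + 1) * blockCount r n ≤ min (r n) n := by
  calc blockCount r n * (Nat.log 2 n + 1) * blockCount r n
      = blockCount r n * blockCount r n * (Nat.log 2 n + 1) := by ring
    _ ≤ min (r n) n / (Nat.log 2 n + 1) * (Nat.log 2 n + 1) :=
      Nat.mul_le_mul_right _ (Nat.sqrt_le _)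
    _ ≤ min (r n) n := Nat.div_mul_le_self _ _

theorem tendsto_blockCount {r : ℕ → ℕ}
    (h : (fun n : ℕ => Real.log (n : ℝ)) =o[Filter.atTop] (fun n : ℕ => (r n : ℝ))) :
    Filter.Tendsto (blockCount r) Filter.atTop Filter.atTop := by
  rw [Filter.tendsto_atTop]
  intro b
  have hid : (fun n : ℕ => Real.log (n : ℝ)) =o[Filter.atTop] (fun n : ℕ => (n : ℝ)) :=
    Real.isLittleO_log_id_atTop.comp_tendsto tendsto_natCast_atTop_atTop
  have hc : (0 : ℝ) < 1 / (3 * (b * b + 1)) := by positivity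
  filter_upwards [h.bound hc, hid.bound hc, Filter.eventually_ge_atTop 3] with n h1 h2 h3
  have hn : (3 : ℝ) ≤ n := by exact_mod_cast h3
  have hlog1 : 1 ≤ Real.log n := by
    rw [Real.le_log_iff_exp_le (by linarith)]
    linarith [Real.exp_one_lt_d9]
  have hlog : ((Nat.log 2 n : ℕ) : ℝ) ≤ 2 * Real.log n := by
    have hpow : ((2 ^ Nat.log 2 n : ℕ) : ℝ) ≤ n := by
      exact_mod_cast Nat.pow_log_le_self 2 (by omega)
    have := Real.log_le_log (by positivity) hpow
    rw [Nat.cast_pow, Real.log_pow, Nat.cast_ofNat] at this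
    have h4 : ((Nat.log 2 n : ℕ) : ℝ) * (1 / 2) ≤ (Nat.log 2 n : ℕ) * Real.log 2 :=
      mul_le_mul_of_nonneg_left (by linarith [Real.log_two_gt_d9]) (Nat.cast_nonneg _)
    linarith
  have hmain : ∀ m : ℕ, ‖Real.log n‖ ≤ 1 / (3 * (b * b + 1)) * ‖(m : ℝ)‖ →
      b * b * (Nat.log 2 n + 1) ≤ m := by
    intro m hm
    rw [Real.norm_of_nonneg (by linarith), Real.norm_of_nonneg (Nat.cast_nonneg _), one_div,
      ← div_eq_inv_mul, le_div_iff₀ (by positivity)] at hm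
    have : (b * b * (Nat.log 2 n + 1) : ℝ) ≤ m := by
      calc (b * b * (Nat.log 2 n + 1) : ℝ) ≤ b * b * (3 * Real.log n) :=
            mul_le_mul_of_nonneg_left (by linarith) (by positivity)
        _ ≤ Real.log n * (3 * (b * b + 1)) := by nlinarith
        _ ≤ m := hm
    exact_mod_cast this
  rw [blockCount, Nat.le_sqrt, Nat.le_div_iff_mul_le (Nat.succ_pos _)]
  exact le_min (hmain _ h1) (hmain _ h2)

/-- A commutative semiring with idempotent addition, with the order `a ≤ b ↔ a + b = b`. For the
min-plus semirings this is opposite to the order of costs. -/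
abbrev idemCommSemiringOfAddSelf {S : Type} [CommSemiring S] (h : ∀ a : S, a + a = a) :
    IdemCommSemiring S where
  __ := ‹CommSemiring S›
  __ := IdemSemiring.ofSemiring h

/-- In the order `a ≤ b ↔ a + b = b`, an element of positive finite cost lies below `1` and has
strictly decreasing powers. -/
theorem exists_cost {R : Type} [AddCommMonoid R] [LinearOrder R] [IsOrderedCancelAddMonoid R]
    {c : R} (hc : 0 < c) :
    ∃ ω : Tropical (WithTop R), ω + 1 = 1 ∧ ∀ n : ℕ, ω ^ n + ω ^ (n + 1) ≠ ω ^ (n + 1) := by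
  refine ⟨Tropical.trop (c : WithTop R), ?_, fun n => ?_⟩
  · rw [Tropical.add_eq_right_iff, ← Tropical.untrop_le_iff, Tropical.untrop_one,
      Tropical.untrop_trop]
    exact_mod_cast hc.le
  · rw [Ne, Tropical.add_eq_right_iff, ← Tropical.untrop_le_iff, Tropical.untrop_pow,
      Tropical.untrop_pow, Tropical.untrop_trop, ← WithTop.coe_nsmul, ← WithTop.coe_nsmul,
      WithTop.coe_le_coe, not_le, succ_nsmul]
    exact lt_add_of_pos_right _ hc

theorem VP_eq_VNP_of_isBigO {S : Type} [IdemCommSemiring S] {r : ℕ → ℕ}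
    (h : (fun n : ℕ => (r n : ℝ)) =O[Filter.atTop] (fun n : ℕ => Real.log (n : ℝ))) :
    VP S = VNP S r := by
  obtain ⟨t, ht⟩ := exists_polynomial_two_pow_le h
  exact (VP_subset_VNP S r).antisymm (VNP_subset_VP_of_two_pow_le t ht)

theorem permFamily_mem_VNP_diff_VP {S : Type} [IdemCommSemiring S] [NoZeroDivisors S]
    [Nontrivial S] (hS : ∃ ω : S, ω + 1 = 1 ∧ ∀ n : ℕ, ω ^ n + ω ^ (n + 1) ≠ ω ^ (n + 1))
    {r : ℕ → ℕ}
    (h : (fun n : ℕ => Real.log (n : ℝ)) =o[Filter.atTop] (fun n : ℕ => (r n : ℝ))) :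
    permFamily S (fun n => blockCount r n * (Nat.log 2 n + 1)) ∈ VNP S r \ VP S := by
  obtain ⟨ω, hω₁, hω⟩ := hS
  exact ⟨permFamily_mem_VNP (blockCount_mul_le r),
    permFamily_notMem_VP (add_eq_right_iff_le.1 hω₁)
      (fun n hn => hω n (add_eq_right_iff_le.2 hn)) (tendsto_blockCount h)⟩

end Asymptotics

theorem mainTheorem1 (r : ℕ → ℕ) :
    ((fun n : ℕ => (r n : ℝ)) =O[Filter.atTop] (fun n : ℕ => Real.log (n : ℝ)) →
      VP MinPlus = VNP MinPlus r ∧ VP MinPlusNN = VNP MinPlusNN r) ∧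
    ((fun n : ℕ => Real.log (n : ℝ)) =o[Filter.atTop] (fun n : ℕ => (r n : ℝ)) →
      VP MinPlus ≠ VNP MinPlus r ∧ VP MinPlusNN ≠ VNP MinPlusNN r ∧
      ∃ β : ℕ → ℕ,
        permFamily MinPlus β ∈ VNP MinPlus r \ VP MinPlus ∧
        permFamily MinPlusNN β ∈ VNP MinPlusNN r \ VP MinPlusNN) := by
  -- The instances are explicit as the order they carry is opposite to the one on `Tropical`.
  refine ⟨fun h => ⟨?_, ?_⟩, fun h => ?_⟩
  · exact @VP_eq_VNP_of_isBigO MinPlus (idemCommSemiringOfAddSelf Tropical.add_self) r h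
  · exact @VP_eq_VNP_of_isBigO MinPlusNN (idemCommSemiringOfAddSelf Tropical.add_self) r h
  · have h1 : permFamily MinPlus (fun n => blockCount r n * (Nat.log 2 n + 1)) ∈
        VNP MinPlus r \ VP MinPlus :=
      @permFamily_mem_VNP_diff_VP MinPlus (idemCommSemiringOfAddSelf Tropical.add_self)
        (inferInstance : NoZeroDivisors MinPlus)
        (inferInstance : Nontrivial MinPlus) (exists_cost (zero_lt_one' ℝ)) r h
    have h2 : permFamily MinPlusNN (fun n => blockCount r n * (Nat.log 2 n + 1)) ∈
        VNP MinPlusNN r \ VP MinPlusNN :=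
      @permFamily_mem_VNP_diff_VP MinPlusNN (idemCommSemiringOfAddSelf Tropical.add_self)
        (inferInstance : NoZeroDivisors MinPlusNN)
        (inferInstance : Nontrivial MinPlusNN) (exists_cost (zero_lt_one' ℝ≥0)) r h
    exact ⟨fun e => h1.2 (e ▸ h1.1), fun e => h2.2 (e ▸ h2.1), _, h1, h2⟩
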